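/- For a positive integer $m$ let $\mathbb{Z}[1/m]=\{a/m^r : a\in\mathbb{Z},\ r\ge 0\}\subseteq\mathbb{Q}$. Let $n>1$ be a square-free integer and let $p>3$ be a prime with $p\nmid n$. Let $\Gamma_0(n,p)$ be the subgroup of the matrices $\begin{pmatrix}a&b\\c&d\end{pmatrix}\in{\rm SL}_2(\mathbb{Z}[1/n])$ with $p\mid c$ in $\mathbb{Z}[1/n]$, and let ${\rm B}(\mathbb{F}_p)\subseteq{\rm SL}_2(\mathbb{F}_p)$ be the subgroup of upper triangular matrices. Consider the inclusions $i_1:\Gamma_0(n,p)\to{\rm SL}_2(\mathbb{Z}[1/n])$ and $j_1:{\rm SL}_2(\mathbb{Z}[1/n])\to{\rm SL}_2(\mathbb{Z}[1/pn])$ and the injective homomorphisms $$i_2':\Gamma_0(n,p)\to{\rm SL}_2(\mathbb{Z}[1/n]),\ \begin{pmatrix}a&b\\c&d\end{pmatrix}\mapsto\begin{pmatrix}a&pb\\p^{-1}c&d\end{pmatrix},\qquad j_2':{\rm SL}_2(\mathbb{Z}[1/n])\to{\rm SL}_2(\mathbb{Z}[1/pn]),\ \begin{pmatrix}a&b\\c&d\end{pmatrix}\mapsto\begin{pmatrix}a&p^{-1}b\\pc&d\end{pmatrix},$$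 which present ${\rm SL}_2(\mathbb{Z}[1/pn])$ as the amalgam ${\rm SL}_2(\mathbb{Z}[1/n])\ast_{\Gamma_0(n,p)}{\rm SL}_2(\mathbb{Z}[1/n])$. Then the Mayer–Vietoris connecting homomorphism $$\partial: H_2({\rm SL}_2(\mathbb{Z}[1/pn]),\mathbb{Z})\to H_1(\Gamma_0(n,p),\mathbb{Z})$$ of this amalgam is well defined: there is a (unique) homomorphism $\partial$ such that $\partial(x)=y$ if and only if there are $2$-chains $\alpha,\beta$ (in the inhomogeneous chain complex with coefficients in $\mathbb{Z}$) of ${\rm SL}_2(\mathbb{Z}[1/n])$ and a $1$-cycle $\gamma$ of $\Gamma_0(n,p)$ in the class $y$ such that $d\alpha=i_{1*}\gamma$, $d\beta=i'_{2*}\gamma$, and $j'_{2*}\beta-j_{1*}\alpha$ is a cycle in the class $x$. Moreover the composition $$\delta_p:\ H_2({\rm SL}_2(\mathbb{Z}[1/pn]),\mathbb{Z})\overset{\partial}{\longrightarrow}H_1(\Gamma_0(n,p),\mathbb{Z})\longrightarrow H_1({\rm B}(\mathbb{F}_p),\mathbb{Z})\longrightarrow\mathbb{F}_p^\times$$ is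 surjective, where the second map is induced by reduction modulo $p$ and the third by $\begin{pmatrix}a&b\\0&a^{-1}\end{pmatrix}\mapsto a$. -/

import Mathlib

open CategoryTheory

noncomputable section

/-! ## Integral homology of groups -/

/-- The trivial `G`-module `ℤ`. -/
abbrev trivZ (G : Type) [Group G] : Rep.{0} ℤ G := Rep.trivial ℤ G ℤ

/-- The integral homology group `H_k(G, ℤ)`. -/
abbrev HZ (G : Type) [Group G] (k : ℕ) : ModuleCat ℤ := groupHomology (trivZ G) k

/-- The identity of `ℤ`, as a map from the trivial `G`-module `ℤ` to the restriction along
`f : G →* H` of the trivial `H`-module `ℤ`. -/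
def trivZHom {G H : Type} [Group G] [Group H] (f : G →* H) :
    trivZ G ⟶ Rep.res f (trivZ H) :=
  Rep.ofHom ⟨LinearMap.id, fun _ => rfl⟩

/-- The map `f_* : H_k(G, ℤ) → H_k(H, ℤ)` induced by a homomorphism `f : G →* H`. -/
def HZmap {G H : Type} [Group G] [Group H] (f : G →* H) (k : ℕ) : HZ G k →+ HZ H k :=
  (groupHomology.map f (trivZHom f) k).hom.toAddMonoidHom

/-- The map `∑ aᵢ·[gᵢ] ↦ ∑ aᵢ·[f gᵢ]` on inhomogeneous 1-chains with coefficients in `ℤ`. -/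
def chain₁ {G H : Type} [Group G] [Group H] (f : G →* H) : (G →₀ ℤ) →ₗ[ℤ] (H →₀ ℤ) :=
  Finsupp.lmapDomain ℤ ℤ f

/-- The map `∑ aᵢ·[gᵢ | hᵢ] ↦ ∑ aᵢ·[f gᵢ | f hᵢ]` on inhomogeneous 2-chains with coefficients
in `ℤ`. -/
def chain₂ {G H : Type} [Group G] [Group H] (f : G →* H) :
    (G × G →₀ ℤ) →ₗ[ℤ] (H × H →₀ ℤ) :=
  Finsupp.lmapDomain ℤ ℤ (Prod.map f f)

/-- The differential from 2-chains to 1-chains of the inhomogeneous chain complex of `ℤ`: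
`[g | h] ↦ [h] - [g h] + [g]`. -/
def bdry₂ (G : Type) [Group G] : (G × G →₀ ℤ) →ₗ[ℤ] (G →₀ ℤ) :=
  (groupHomology.d₂₁ (trivZ G)).hom

/-- The graph of the Mayer–Vietoris connecting map `H_2(G, ℤ) → H_1(C, ℤ)` of a square of groups
`i₁ : C → A`, `i₂ : C → B`, `j₁ : A → G`, `j₂ : B → G`.

It is the zigzag that belongs to the maps of chains `c ↦ (i₁ c, i₂ c)` and
`(a, b) ↦ j₂ b - j₁ a`: a pair `(x, y)` is in the graph when there are 2-chains `a` of `A` and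
`b` of `B` such that `j₂ b - j₁ a` is a cycle in the class `x`, and a 1-cycle `c` of `C` in the
class `y`, with `∂ a = i₁ c` and `∂ b = i₂ c`. -/
def mayerVietorisGraph {C A B G : Type} [Group C] [Group A] [Group B] [Group G]
    (i₁ : C →* A) (i₂ : C →* B) (j₁ : A →* G) (j₂ : B →* G) :
    AddSubgroup (HZ G 2 × HZ C 1) where
  carrier := {xy | ∃ (a : A × A →₀ ℤ) (b : B × B →₀ ℤ)
    (c : groupHomology.cycles₁ (trivZ C)) (z : groupHomology.cycles₂ (trivZ G)),
      bdry₂ A a = chain₁ i₁ c.1 ∧ bdry₂ B b = chain₁ i₂ c.1 ∧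
      z.1 = chain₂ j₂ b - chain₂ j₁ a ∧
      groupHomology.H2π (trivZ G) z = xy.1 ∧ groupHomology.H1π (trivZ C) c = xy.2}
  zero_mem' := ⟨0, 0, 0, 0, by simp, by simp, by simp, by simp, by simp⟩
  add_mem' := by
    rintro _ _ ⟨a, b, c, z, h1, h2, h3, h4, h5⟩ ⟨a', b', c', z', h1', h2', h3', h4', h5'⟩
    refine ⟨a + a', b + b', c + c', z + z', ?_, ?_, ?_, ?_, ?_⟩
    · rw [map_add, h1, h1', ← map_add]; rfl
    · rw [map_add, h2, h2', ← map_add]; rfl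
    · rw [map_add, map_add, add_sub_add_comm, ← h3, ← h3']; rfl
    · rw [map_add, h4, h4']; rfl
    · rw [map_add, h5, h5']; rfl
  neg_mem' := by
    rintro _ ⟨a, b, c, z, h1, h2, h3, h4, h5⟩
    refine ⟨-a, -b, -c, -z, ?_, ?_, ?_, ?_, ?_⟩
    · rw [map_neg, h1, ← map_neg]; rfl
    · rw [map_neg, h2, ← map_neg]; rfl
    · rw [map_neg, map_neg, ← neg_sub', ← h3]; rfl
    · rw [map_neg, h4]; rfl
    · rw [map_neg, h5]; rfl

/-! ## The ring `ℤ[1/n]` and its reduction modulo `p` -/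

/-- The subring `ℤ[1/n] = {a / n ^ r : a ∈ ℤ, r ≥ 0}` of `ℚ`. -/
def ZInv (n : ℕ) : Subring ℚ where
  carrier := {x | ∃ (a : ℤ) (r : ℕ), x = a / (n : ℚ) ^ r}
  zero_mem' := ⟨0, 0, by simp⟩
  one_mem' := ⟨1, 0, by simp⟩
  neg_mem' := by
    rintro _ ⟨a, r, rfl⟩
    exact ⟨-a, r, by push_cast; ring⟩
  mul_mem' := by
    rintro _ _ ⟨a, r, rfl⟩ ⟨b, s, rfl⟩
    exact ⟨a * b, r + s, by push_cast; rw [div_mul_div_comm, pow_add]⟩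
  add_mem' := by
    rintro _ _ ⟨a, r, rfl⟩ ⟨b, s, rfl⟩
    rcases Nat.eq_zero_or_pos n with rfl | hn
    · rcases Nat.eq_zero_or_pos r with rfl | hr <;> rcases Nat.eq_zero_or_pos s with rfl | hs
      · exact ⟨a + b, 0, by simp⟩
      · exact ⟨a, 0, by simp [hs.ne']⟩
      · exact ⟨b, 0, by simp [hr.ne']⟩
      · exact ⟨0, 0, by simp [hr.ne', hs.ne']⟩
    · have h : (n : ℚ) ≠ 0 := by exact_mod_cast hn.ne'
      exact ⟨a * n ^ s + b * n ^ r, r + s, by push_cast; rw [div_add_div _ _ (pow_ne_zero r h) (pow_ne_zero s h), pow_add]; ring⟩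

theorem mem_ZInv_iff {n : ℕ} {x : ℚ} :
    x ∈ ZInv n ↔ ∃ (a : ℤ) (r : ℕ), x = a / (n : ℚ) ^ r := Iff.rfl

theorem ZInv_le_mul {n p : ℕ} (hp : p ≠ 0) : ZInv n ≤ ZInv (p * n) := by
  rintro _ ⟨a, r, rfl⟩
  have h : (p : ℚ) ≠ 0 := by exact_mod_cast hp
  refine ⟨a * p ^ r, r, ?_⟩
  push_cast
  rw [mul_pow, mul_comm ((p : ℚ) ^ r), mul_div_mul_right _ _ (pow_ne_zero r h)]

theorem inv_mem_ZInv {n p : ℕ} (hn : n ≠ 0) : (p : ℚ)⁻¹ ∈ ZInv (p * n) := by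
  have h : (n : ℚ) ≠ 0 := by exact_mod_cast hn
  refine ⟨n, 1, ?_⟩
  push_cast
  rw [pow_one, div_mul_cancel_right₀ h]

theorem ZInv_den_ne_zero {n p : ℕ} [hp : Fact p.Prime] (hpn : ¬ p ∣ n) (x : ZInv n) :
    (((x : ℚ).den : ℕ) : ZMod p) ≠ 0 := by
  obtain ⟨x, a, r, rfl⟩ := x
  rw [Ne, ZMod.natCast_eq_zero_iff]
  intro h
  have h1 : (((a / (n : ℚ) ^ r : ℚ).den : ℕ) : ℤ) ∣ ((n ^ r : ℕ) : ℤ) := by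
    have := Rat.den_dvd a ((n ^ r : ℕ) : ℤ)
    rw [Rat.divInt_eq_div] at this
    push_cast at this ⊢
    exact this
  exact hpn (hp.out.dvd_of_dvd_pow (h.trans (Int.natCast_dvd_natCast.mp h1)))

/-- The reduction map `ℤ[1/n] → 𝔽_p`, `a / n ^ r ↦ a / n ^ r`, for a prime `p` not dividing `n`
(see `ZInv_red_apply`). -/
def ZInv.red (n p : ℕ) [Fact p.Prime] (hpn : ¬ p ∣ n) : ZInv n →+* ZMod p where
  toFun x := ((x : ℚ) : ZMod p)
  map_zero' := by simp
  map_one' := by simp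
  map_add' x y := by
    simpa using Rat.cast_add_of_ne_zero (ZInv_den_ne_zero hpn x) (ZInv_den_ne_zero hpn y)
  map_mul' x y := by
    simpa using Rat.cast_mul_of_ne_zero (ZInv_den_ne_zero hpn x) (ZInv_den_ne_zero hpn y)

theorem ZInv_red_apply (n p : ℕ) [Fact p.Prime] (hpn : ¬ p ∣ n) (a : ℤ) (r : ℕ) :
    ZInv.red n p hpn ⟨a / (n : ℚ) ^ r, a, r, rfl⟩ = (a : ZMod p) / (n : ZMod p) ^ r := by
  have hn : (n : ZMod p) ≠ 0 := by rwa [Ne, ZMod.natCast_eq_zero_iff]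
  have hnQ : (n : ℚ) ≠ 0 := by
    rintro h
    exact hpn (by rw [Nat.cast_eq_zero.mp h]; exact dvd_zero p)
  rw [eq_div_iff (pow_ne_zero r hn)]
  have h1 : ((n : ZMod p)) = ZInv.red n p hpn (n : ZInv n) := by simp
  have h2 : ((a : ZMod p)) = ZInv.red n p hpn (a : ZInv n) := by simp
  rw [h1, h2, ← map_pow, ← map_mul]
  congr 1
  ext
  push_cast
  exact div_mul_cancel₀ _ (pow_ne_zero r hnQ)

/-! ## The groups of the amalgam -/

/-- `SL_2(ℤ[1/n])`. -/
abbrev SL2Z (n : ℕ) : Type := Matrix.SpecialLinearGroup (Fin 2) (ZInv n)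

/-- `Γ_0(n, p)`: the matrices in `SL_2(ℤ[1/n])` whose lower left entry is divisible by `p`
in `ℤ[1/n]`. -/
def Gamma0 (n p : ℕ) : Subgroup (SL2Z n) where
  carrier := {g | (p : ZInv n) ∣ g 1 0}
  one_mem' := by simp
  mul_mem' := by
    intro g h hg hh
    simp only [Set.mem_ofPred_eq, Matrix.SpecialLinearGroup.coe_mul, Matrix.mul_apply,
      Fin.sum_univ_two] at *
    exact dvd_add (hg.mul_right _) (hh.mul_left _)
  inv_mem' := by
    intro g hg
    simp only [Set.mem_ofPred_eq] at *
    rw [Matrix.SpecialLinearGroup.SL2_inv_expl]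
    simpa using hg

/-- The inclusion `i_1 : Γ_0(n, p) → SL_2(ℤ[1/n])`. -/
def iOne (n p : ℕ) : Gamma0 n p →* SL2Z n := (Gamma0 n p).subtype

theorem Gamma0_lower_mem {n p : ℕ} (hp : p ≠ 0) (g : Gamma0 n p) :
    (p : ℚ)⁻¹ * ((g : SL2Z n) 1 0 : ℚ) ∈ ZInv n := by
  obtain ⟨k, hk⟩ := g.2
  have h : (p : ℚ) ≠ 0 := by exact_mod_cast hp
  rw [hk]
  push_cast
  rw [inv_mul_cancel_left₀ h]
  exact k.2

theorem SL2_det_eq {R : Type} [CommRing R] (g : Matrix.SpecialLinearGroup (Fin 2) R) :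
    g 0 0 * g 1 1 - g 0 1 * g 1 0 = 1 := by
  rw [← Matrix.det_fin_two]; exact g.2

/-- The matrix `(a, b; c, d)` as an element of `SL_2(R)`. -/
def mkSL2 {R : Type} [CommRing R] (a b c d : R) (h : a * d - b * c = 1) :
    Matrix.SpecialLinearGroup (Fin 2) R :=
  ⟨!![a, b; c, d], by rw [Matrix.det_fin_two_of, h]⟩

theorem mkSL2_eq_mul {R : Type} [CommRing R] {a b c d : R} {h : a * d - b * c = 1}
    {x y : Matrix.SpecialLinearGroup (Fin 2) R}
    (ha : a = x 0 0 * y 0 0 + x 0 1 * y 1 0) (hb : b = x 0 0 * y 0 1 + x 0 1 * y 1 1)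
    (hc : c = x 1 0 * y 0 0 + x 1 1 * y 1 0) (hd : d = x 1 0 * y 0 1 + x 1 1 * y 1 1) :
    mkSL2 a b c d h = x * y := by
  ext i j
  rw [Matrix.SpecialLinearGroup.coe_mul, Matrix.mul_apply, Fin.sum_univ_two]
  fin_cases i <;> fin_cases j
  exacts [ha, hb, hc, hd]

theorem SL2_mul_entry {R : Type} [CommRing R] (x y : Matrix.SpecialLinearGroup (Fin 2) R)
    (i j : Fin 2) : (x * y) i j = x i 0 * y 0 j + x i 1 * y 1 j := by
  rw [Matrix.SpecialLinearGroup.coe_mul, Matrix.mul_apply, Fin.sum_univ_two]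

/-- The map `i_2' : Γ_0(n, p) → SL_2(ℤ[1/n])`, `(a, b; c, d) ↦ (a, p b; p⁻¹ c, d)`. -/
def iTwo (n p : ℕ) (hp : p ≠ 0) : Gamma0 n p →* SL2Z n where
  toFun g := mkSL2 ((g : SL2Z n) 0 0) ((p : ZInv n) * (g : SL2Z n) 0 1)
    ⟨(p : ℚ)⁻¹ * ((g : SL2Z n) 1 0 : ℚ), Gamma0_lower_mem hp g⟩ ((g : SL2Z n) 1 1) (by
      have h : (p : ℚ) ≠ 0 := by exact_mod_cast hp
      have hd := congrArg (fun x : ZInv n => (x : ℚ)) (SL2_det_eq (g : SL2Z n))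
      ext
      push_cast at hd ⊢
      rw [← hd]
      field_simp)
  map_one' := by
    ext i j
    fin_cases i <;> fin_cases j <;> simp [mkSL2]
  map_mul' g g' := by
    have h : (p : ℚ) ≠ 0 := by exact_mod_cast hp
    have e (i j : Fin 2) : ((g * g' : Gamma0 n p) : SL2Z n) i j = _ :=
      SL2_mul_entry (g : SL2Z n) (g' : SL2Z n) i j
    apply mkSL2_eq_mul
    · rw [e]; ext; simp [mkSL2]; field_simp
    · rw [e]; ext; simp [mkSL2]; field_simp
    · ext
      change (p : ℚ)⁻¹ * ((((g * g' : Gamma0 n p) : SL2Z n) 1 0 : ZInv n) : ℚ) = _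
      rw [e]; simp [mkSL2]; field_simp
    · rw [e]; ext; simp [mkSL2]; field_simp

/-- The inclusion `j_1 : SL_2(ℤ[1/n]) → SL_2(ℤ[1/pn])`. -/
def jOne (n p : ℕ) (hp : p ≠ 0) : SL2Z n →* SL2Z (p * n) :=
  Matrix.SpecialLinearGroup.map (Subring.inclusion (ZInv_le_mul hp))

/-- The map `j_2' : SL_2(ℤ[1/n]) → SL_2(ℤ[1/pn])`, `(a, b; c, d) ↦ (a, p⁻¹ b; p c, d)`. -/
def jTwo (n p : ℕ) (hp : p ≠ 0) (hn : n ≠ 0) : SL2Z n →* SL2Z (p * n) where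
  toFun g := mkSL2 (Subring.inclusion (ZInv_le_mul hp) (g 0 0))
    (⟨(p : ℚ)⁻¹, inv_mem_ZInv hn⟩ * Subring.inclusion (ZInv_le_mul hp) (g 0 1))
    ((p : ZInv (p * n)) * Subring.inclusion (ZInv_le_mul hp) (g 1 0))
    (Subring.inclusion (ZInv_le_mul hp) (g 1 1)) (by
      have h : (p : ℚ) ≠ 0 := by exact_mod_cast hp
      have hd := congrArg (fun x : ZInv n => (x : ℚ)) (SL2_det_eq g)
      ext
      push_cast [Subring.coe_inclusion] at hd ⊢
      rw [← hd]
      field_simp)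
  map_one' := by
    ext i j
    fin_cases i <;> fin_cases j <;> simp [mkSL2]
  map_mul' g g' := by
    have h : (p : ℚ) ≠ 0 := by exact_mod_cast hp
    apply mkSL2_eq_mul <;> ext <;> rw [SL2_mul_entry] <;> simp [mkSL2] <;> field_simp

/-- The subgroup `B(𝔽_p)` of upper triangular matrices in `SL_2(𝔽_p)`. -/
def BorelSL2 (p : ℕ) : Subgroup (Matrix.SpecialLinearGroup (Fin 2) (ZMod p)) where
  carrier := {g | g 1 0 = 0}
  one_mem' := by simp
  mul_mem' := by
    intro g h hg hh
    simp only [Set.mem_ofPred_eq, Matrix.SpecialLinearGroup.coe_mul, Matrix.mul_apply,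
      Fin.sum_univ_two] at *
    simp [hg, hh]
  inv_mem' := by
    intro g hg
    simp only [Set.mem_ofPred_eq] at *
    rw [Matrix.SpecialLinearGroup.SL2_inv_expl]
    simpa using hg

/-- The reduction map `Γ_0(n, p) → B(𝔽_p)`. -/
def redBorel (n p : ℕ) [Fact p.Prime] (hpn : ¬ p ∣ n) : Gamma0 n p →* BorelSL2 p :=
  ((Matrix.SpecialLinearGroup.map (ZInv.red n p hpn)).comp (Gamma0 n p).subtype).codRestrict
    (BorelSL2 p) (by
      intro g
      obtain ⟨k, hk⟩ := g.2
      change ZInv.red n p hpn ((g : SL2Z n) 1 0) = 0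
      rw [hk, map_mul, map_natCast, ZMod.natCast_self, zero_mul])

theorem Borel_diag {p : ℕ} (g : BorelSL2 p) : g.1 0 0 * g.1 1 1 = 1 := by
  have h := SL2_det_eq g.1
  have h0 : g.1 1 0 = 0 := g.2
  rwa [h0, mul_zero, sub_zero] at h

/-- The projection `pr : B(𝔽_p) → 𝔽_p^×`, `(a, b; 0, a⁻¹) ↦ a`. -/
def borelPr (p : ℕ) : BorelSL2 p →* (ZMod p)ˣ where
  toFun g := ⟨g.1 0 0, g.1 1 1, Borel_diag g, by rw [mul_comm]; exact Borel_diag g⟩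
  map_one' := by ext; simp
  map_mul' g h := by
    have h0 : h.1 1 0 = 0 := h.2
    ext
    simp [Matrix.mul_apply, Fin.sum_univ_two, h0]

/-! ## The map to `𝔽_p^×` -/

/-- The homomorphism `H_1(G, ℤ) → M` that a homomorphism `f : G → M` to an abelian group induces
through `H_1(G, ℤ) ≅ G^ab ⊗ ℤ ≅ G^ab`; it sends the class of `[g]` to `f g`. -/
def H1Lift {G M : Type} [Group G] [CommGroup M] (f : G →* M) : HZ G 1 →+ Additive M :=
  (MonoidHom.toAdditive (Abelianization.lift f)).comp
    ((TensorProduct.rid ℤ (Additive (Abelianization G))).toLinearMap.toAddMonoidHom.comp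
      (groupHomology.H1AddEquivOfIsTrivial (trivZ G)).toAddMonoidHom)

theorem H1Lift_apply {G M : Type} [Group G] [CommGroup M] (f : G →* M) (g : G) :
    H1Lift f (groupHomology.H1π (trivZ G)
      ((groupHomology.cycles₁IsoOfIsTrivial (trivZ G)).inv (Finsupp.single g (1 : ℤ)))) =
      Additive.ofMul (f g) := by
  have h := groupHomology.H1AddEquivOfIsTrivial_single (trivZ G) g (1 : ℤ)
  refine (congrArg (fun t => MonoidHom.toAdditive (Abelianization.lift f)
    (TensorProduct.rid ℤ (Additive (Abelianization G)) t)) h).trans ?_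
  rw [TensorProduct.rid_tmul, one_smul]
  exact congrArg Additive.ofMul (Abelianization.lift_apply_of f g)

/-- The composition `H_1(Γ_0(n, p), ℤ) → H_1(B(𝔽_p), ℤ) → 𝔽_p^×`. -/
def H1ToUnits (n p : ℕ) [Fact p.Prime] (hpn : ¬ p ∣ n) :
    HZ (Gamma0 n p) 1 →+ Additive (ZMod p)ˣ :=
  (H1Lift (borelPr p)).comp (HZmap (redBorel n p hpn) 1)

/-- `conn : H_2(SL_2(ℤ[1/pn]), ℤ) → H_1(Γ_0(n, p), ℤ)` is the connecting map of the Mayer–Vietoris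
sequence of the decomposition of `SL_2(ℤ[1/pn])` as the amalgam of two copies of `SL_2(ℤ[1/n])`
over `Γ_0(n, p)`, embedded by `i_1` and `i_2'`. -/
def IsMayerVietorisConnecting (n p : ℕ) (hp : p ≠ 0) (hn : n ≠ 0)
    (conn : HZ (SL2Z (p * n)) 2 →+ HZ (Gamma0 n p) 1) : Prop :=
  conn.graph = mayerVietorisGraph (iOne n p) (iTwo n p hp) (jOne n p hp) (jTwo n p hp hn)

end

/-! The zigzag relation of an amalgam `G = A *_C B` is shown to be the graph of a homomorphism by
means of cocycles. It is single-valued because every homomorphism `φ : C → M` arises from a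
2-cocycle of `G` that restricts to coboundaries of cochains `α`, `β` on the factors, with `β ∘ i₂ -
α ∘ i₁ = φ` (`IsAmalgam.exists_cocycle`). For `M = H_1(C)`, evaluating it on a zigzag with `x = 0`
gives `y = 0`. It is everywhere defined because a `ℚ/ℤ`-valued character of `H_2(G)` killing its
domain is given by a cocycle that is trivialized on the factors by cochains agreeing on `C`. Such a
cocycle is a coboundary (`IsAmalgam.exists_coboundary`), so the character is zero.

That `SL_2(ℤ[1/pn])` is an amalgam (`isAmalgam_SL2Z`) is a `p`-adic ping-pong argument. A letter
outside the common subgroup has an off-diagonal entry of norm 1, so in a reduced word of at least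
two letters some column acquires norm greater than 1, which no element of `Γ_0(n, p)` allows.
Generation follows from Bézout's identity and diagonal matrices.

For surjectivity, the class of `g` is in the image of `∂` once `i_1 g` and `i_2' g` die in
`H_1(SL_2(ℤ[1/n]))`. Integral matrices congruent to 1 modulo 12 are products of commutators in
`SL_2(ℤ)` (`hom_eq_one_of_congr_one`). Given `u`, the matrix `g = (a, 12b; 12p, d)` with `a ≡ 1`
modulo 12 and `a ≡ u` modulo `p` has both images of this kind, and `δ_p` reaches `u`. -/

noncomputable section

/-! ### Low-degree chains and the evaluation of cochains on them -/

section Chains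

variable {G H : Type} [Group G] [Group H]

theorem bdry₂_single (g h : G) (a : ℤ) :
    bdry₂ G (Finsupp.single (g, h) a) =
      Finsupp.single h a - Finsupp.single (g * h) a + Finsupp.single g a :=
  groupHomology.d₂₁_single (A := trivZ G) (g, h) a

theorem chain₁_single (f : G →* H) (g : G) (a : ℤ) :
    chain₁ f (Finsupp.single g a) = Finsupp.single (f g) a := by
  simp [chain₁]

theorem chain₂_single (f : G →* H) (g h : G) (a : ℤ) :
    chain₂ f (Finsupp.single (g, h) a) = Finsupp.single (f g, f h) a := by
  simp [chain₂]

theorem bdry₂_chain₂ (f : G →* H) (x : G × G →₀ ℤ) :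
    bdry₂ H (chain₂ f x) = chain₁ f (bdry₂ G x) := by
  suffices h : (bdry₂ H) ∘ₗ (chain₂ f) = (chain₁ f) ∘ₗ (bdry₂ G) from LinearMap.congr_fun h x
  ext ⟨g, h⟩
  simp [chain₂_single, bdry₂_single, chain₁_single]

variable {M : Type} [AddCommGroup M]

theorem linearCombination_chain₁ (u : H → M) (f : G →* H) (x : G →₀ ℤ) :
    Finsupp.linearCombination ℤ u (chain₁ f x) = Finsupp.linearCombination ℤ (u ∘ f) x :=
  Finsupp.linearCombination_mapDomain ℤ f x

theorem linearCombination_chain₂ (u : H × H → M) (f : G →* H) (x : G × G →₀ ℤ) :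
    Finsupp.linearCombination ℤ u (chain₂ f x) =
      Finsupp.linearCombination ℤ (fun y : G × G => u (f y.1, f y.2)) x :=
  Finsupp.linearCombination_mapDomain ℤ (Prod.map f f) x

theorem linearCombination_bdry₂ (u : G → M) (x : G × G →₀ ℤ) :
    Finsupp.linearCombination ℤ u (bdry₂ G x) =
      Finsupp.linearCombination ℤ (fun y : G × G => u y.2 - u (y.1 * y.2) + u y.1) x := by
  suffices h : (Finsupp.linearCombination ℤ u) ∘ₗ (bdry₂ G) =
      Finsupp.linearCombination ℤ (fun y : G × G => u y.2 - u (y.1 * y.2) + u y.1) from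
    LinearMap.congr_fun h x
  ext ⟨g, h⟩
  simp [bdry₂_single]

/-- A 2-cocycle vanishes on 2-boundaries. -/
theorem linearCombination_eq_zero_of_mem_boundaries₂ (f : G → G → M)
    (hf : ∀ g h k, f h k + f g (h * k) = f g h + f (g * h) k) {x : G × G →₀ ℤ}
    (hx : x ∈ groupHomology.boundaries₂ (trivZ G)) :
    Finsupp.linearCombination ℤ (fun y : G × G => f y.1 y.2) x = 0 := by
  obtain ⟨w, rfl⟩ := hx
  suffices h : (Finsupp.linearCombination ℤ (fun y : G × G => f y.1 y.2)) ∘ₗ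
      (groupHomology.d₃₂ (trivZ G)).hom = 0 from LinearMap.congr_fun h w
  apply Finsupp.lhom_ext
  rintro ⟨g, h, k⟩ a
  have e : (groupHomology.d₃₂ (trivZ G)).hom (Finsupp.single (g, h, k) a) =
      Finsupp.single (h, k) a - Finsupp.single (g * h, k) a + Finsupp.single (g, h * k) a -
        Finsupp.single (g, h) a :=
    groupHomology.d₃₂_single (A := trivZ G) (g, h, k) a
  rw [LinearMap.comp_apply, e]
  simp only [map_add, map_sub, Finsupp.linearCombination_single, LinearMap.zero_apply]
  rw [← smul_sub, ← smul_add, ← smul_sub, ← smul_zero a]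
  congr 1
  have := hf g h k
  rw [sub_add_eq_add_sub, this]
  abel

theorem mem_cycles₁_trivZ (x : G →₀ ℤ) : x ∈ groupHomology.cycles₁ (trivZ G) := by
  rw [groupHomology.cycles₁_eq_top_of_isTrivial]
  exact Submodule.mem_top

/-- The homomorphism `G → H_1(G, ℤ)`. -/
def toHZOne (G : Type) [Group G] : G →* Multiplicative (HZ G 1) where
  toFun g := Multiplicative.ofAdd (groupHomology.H1π (trivZ G)
    ⟨Finsupp.single g (1 : ℤ), mem_cycles₁_trivZ _⟩)
  map_one' := by
    rw [← ofAdd_zero]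
    congr 1
    refine (groupHomology.H1π_eq_zero_iff _).2 ?_
    exact groupHomology.single_one_mem_boundaries₁ (A := trivZ G) 1
  map_mul' g h := by
    rw [← ofAdd_add]
    congr 1
    rw [← map_add, eq_comm]
    refine (groupHomology.H1π_eq_iff _ _).2 ⟨Finsupp.single (g, h) (1 : ℤ), ?_⟩
    refine (bdry₂_single g h 1).trans ?_
    change _ = (Finsupp.single g 1 + Finsupp.single h 1 : G →₀ ℤ) - Finsupp.single (g * h) 1
    abel

theorem linearCombination_toHZOne (t : HZ G 1 →+ M) (c : groupHomology.cycles₁ (trivZ G)) :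
    Finsupp.linearCombination ℤ (fun g => t (toHZOne G g).toAdd) c.1 =
      t (groupHomology.H1π (trivZ G) c) := by
  let e : (G →₀ ℤ) →+ groupHomology.cycles₁ (trivZ G) :=
    (LinearMap.codRestrict _ LinearMap.id mem_cycles₁_trivZ : (G →₀ ℤ) →ₗ[ℤ] _).toAddMonoidHom
  have h : (Finsupp.linearCombination ℤ (fun g => t (toHZOne G g).toAdd)).toAddMonoidHom =
      t.comp ((groupHomology.H1π (trivZ G)).hom.toAddMonoidHom.comp e) := by
    ext g
    exact (Finsupp.linearCombination_single ℤ _ _).trans (one_smul ℤ _)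
  exact DFunLike.congr_fun h c.1

end Chains

/-! ### Amalgams, and 2-cocycles built from homomorphisms on the common subgroup -/

/-- The square `i₁ : C → A`, `i₂ : C → B`, `j₁ : A → G`, `j₂ : B → G` presents `G` as the
amalgam of `A` and `B` over a common subgroup `C`. -/
structure IsAmalgam {C A B G : Type} [Group C] [Group A] [Group B] [Group G]
    (i₁ : C →* A) (i₂ : C →* B) (j₁ : A →* G) (j₂ : B →* G) : Prop where
  comm : j₁.comp i₁ = j₂.comp i₂
  injective : Function.Injective (j₁.comp i₁)
  sup_range : j₁.range ⊔ j₂.range = ⊤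
  exists_hom : ∀ (K : Type) [Monoid K] (f : A →* K) (g : B →* K), f.comp i₁ = g.comp i₂ →
    ∃ h : G →* K, h.comp j₁ = f ∧ h.comp j₂ = g

/-- A homomorphism on a subgroup extends to a function which is equivariant under left
multiplication. -/
theorem exists_equivariant_extension {C G M : Type} [Group C] [Group G] [CommGroup M]
    {i : C →* G} (hi : Function.Injective i) (φ : C →* M) :
    ∃ l : G → M, ∀ c g, l (i c * g) = φ c * l g := by
  -- A fixed representative of the right coset `i(C) g`. The extension sends `g` to `φ` of the
  -- element of `C` that carries `r g` to `g`.
  let r (g : G) : G := (Quotient.mk (QuotientGroup.rightRel i.range) g).out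
  have hr (g : G) : ∃ c, g = i c * r g := by
    have h : QuotientGroup.rightRel i.range (r g) g :=
      Quotient.exact (Quotient.out_eq (Quotient.mk (QuotientGroup.rightRel i.range) g))
    rw [QuotientGroup.rightRel_apply] at h
    obtain ⟨c, hc⟩ := h
    exact ⟨c, by rw [hc]; group⟩
  have hrc (c : C) (g : G) : r (i c * g) = r g := by
    have : Quotient.mk (QuotientGroup.rightRel i.range) (i c * g) =
        Quotient.mk (QuotientGroup.rightRel i.range) g := by
      apply Quotient.sound
      change QuotientGroup.rightRel i.range _ _
      rw [QuotientGroup.rightRel_apply]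
      exact ⟨c⁻¹, by simp⟩
    simp only [r, this]
  choose k hk using hr
  refine ⟨fun g => φ (k g), fun c g => ?_⟩
  dsimp only
  rw [← map_mul]
  congr 1
  apply hi
  rw [map_mul]
  apply mul_right_cancel (b := r g)
  rw [mul_assoc, ← hk g, ← hrc c g, ← hk]

section Connecting

variable {C A B G : Type} [Group C] [Group A] [Group B] [Group G]
  {i₁ : C →* A} {i₂ : C →* B} {j₁ : A →* G} {j₂ : B →* G}

/-- Homomorphisms of the factors to a group `P` which agree on `C` up to a central
homomorphism `φ` give rise to a 2-cocycle of the amalgam which is a coboundary on the factors. -/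
theorem IsAmalgam.exists_cocycle_of_central (h : IsAmalgam i₁ i₂ j₁ j₂) {M P : Type}
    [AddCommGroup M] [Group P] (N : Multiplicative M →* P) (hN : Function.Injective N)
    (hc : ∀ m x, N m * x = x * N m) (sA : A →* P) (sB : B →* P) (φ : C →* Multiplicative M)
    (hs : ∀ c, sA (i₁ c) = sB (i₂ c) * N (φ c)) :
    ∃ (f : G → G → M) (α : A → M) (β : B → M),
      (∀ g h k, f h k + f g (h * k) = f g h + f (g * h) k) ∧
      (∀ x y, f (j₁ x) (j₁ y) = α y - α (x * y) + α x) ∧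
      (∀ x y, f (j₂ x) (j₂ y) = β y - β (x * y) + β x) ∧
      ∀ c, β (i₂ c) - α (i₁ c) = (φ c).toAdd := by
  have : N.range.Normal := ⟨by
    rintro _ ⟨m, rfl⟩ x
    exact ⟨m, by rw [← hc, mul_inv_cancel_right]⟩⟩
  -- Modulo the central image of `M` the two homomorphisms agree on `C`, so they glue to `q` on `G`.
  -- The cocycle `f` is the factor set of a set-theoretic lift `s` of `q`, while `α` and `β` compare
  -- `s` with `sA` and `sB`.
  obtain ⟨q, hq₁, hq₂⟩ := h.exists_hom (P ⧸ N.range) ((QuotientGroup.mk' _).comp sA)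
    ((QuotientGroup.mk' _).comp sB) (by
      ext c
      refine (QuotientGroup.eq.2 (MonoidHom.mem_range.2 ⟨φ c, ?_⟩)).symm
      simp [hs])
  have key (x y : P) (hxy : (x : P ⧸ N.range) = y) : ∃ m : M, x = N (.ofAdd m) * y := by
    obtain ⟨m, hm⟩ := QuotientGroup.eq.1 hxy.symm
    exact ⟨m.toAdd, by rw [ofAdd_toAdd, hc, hm]; group⟩
  let s (g : G) : P := (q g).out
  have hs' (g : G) : (s g : P ⧸ N.range) = q g := Quotient.out_eq (q g)
  choose f hf using fun g g' => key (s g * s g') (s (g * g')) (by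
    rw [QuotientGroup.mk_mul, hs', hs', hs', map_mul])
  choose α hα using fun x => key (s (j₁ x)) (sA x) (by
    rw [hs']; exact DFunLike.congr_fun hq₁ x)
  choose β hβ using fun x => key (s (j₂ x)) (sB x) (by
    rw [hs']; exact DFunLike.congr_fun hq₂ x)
  have inj {m m' : M} {x : P} (hm : N (.ofAdd m) * x = N (.ofAdd m') * x) : m = m' :=
    Multiplicative.ofAdd.injective (hN (mul_right_cancel hm))
  have key₂ (m m' : M) (x y : P) : (N (.ofAdd m) * x) * (N (.ofAdd m') * y) =
      N (.ofAdd (m + m')) * (x * y) := by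
    rw [mul_assoc, ← mul_assoc x, ← hc, ofAdd_add, map_mul]
    simp only [mul_assoc]
  refine ⟨f, α, β, fun g g' k => ?_, fun x y => ?_, fun x y => ?_, fun c => ?_⟩
  · apply inj (x := s (g * g' * k))
    rw [ofAdd_add, ofAdd_add, map_mul, map_mul, mul_assoc (N _), mul_assoc (N _), ← hf (g * g') k,
      mul_assoc g, ← hf, ← mul_assoc, hc, mul_assoc, ← hf, ← mul_assoc (N _), ← hf, mul_assoc]
  · have e := hf (j₁ x) (j₁ y)
    rw [← map_mul, hα, hα, hα, key₂, ← mul_assoc (N _) (N _), ← map_mul, ← map_mul,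
      ← ofAdd_add] at e
    have := inj e
    rw [sub_add_eq_add_sub, eq_sub_iff_add_eq, ← this, add_comm]
  · have e := hf (j₂ x) (j₂ y)
    rw [← map_mul, hβ, hβ, hβ, key₂, ← mul_assoc (N _) (N _), ← map_mul, ← map_mul,
      ← ofAdd_add] at e
    have := inj e
    rw [sub_add_eq_add_sub, eq_sub_iff_add_eq, ← this, add_comm]
  · have e₁ := hα (i₁ c)
    rw [← MonoidHom.comp_apply, h.comm, MonoidHom.comp_apply, hβ, hs, ← hc, ← mul_assoc,
      ← map_mul, ← ofAdd_toAdd (φ c), ← ofAdd_add] at e₁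
    rw [inj e₁, add_sub_cancel_left]

/-- Let `P = (G → M) ⋊ G`, where `G` translates functions; the constant functions form a central
copy of `M`. Embed `A` through `j₁`, and `B` through `j₂` followed by conjugation by `l⁻¹`, where
`l` is an equivariant extension of `φ`. By equivariance the two maps differ at `c` by the constant
`φ c`. -/
theorem IsAmalgam.exists_cocycle (h : IsAmalgam i₁ i₂ j₁ j₂) {M : Type}
    [AddCommGroup M] (φ : C →* Multiplicative M) :
    ∃ (f : G → G → M) (α : A → M) (β : B → M),
      (∀ g h k, f h k + f g (h * k) = f g h + f (g * h) k) ∧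
      (∀ x y, f (j₁ x) (j₁ y) = α y - α (x * y) + α x) ∧
      (∀ x y, f (j₂ x) (j₂ y) = β y - β (x * y) + β x) ∧
      ∀ c, β (i₂ c) - α (i₁ c) = (φ c).toAdd := by
  obtain ⟨l, hl⟩ := exists_equivariant_extension h.injective φ
  have hmul (x : G) (u : G → Multiplicative M) (g : G) : mulAutArrow x u g = u (x⁻¹ * g) := rfl
  refine h.exists_cocycle_of_central (P := (G → Multiplicative M) ⋊[mulAutArrow] G)
    (SemidirectProduct.inl.comp (Pi.constMonoidHom G (Multiplicative M)))
    (fun x y hxy => ?_) (fun m x => ?_) (SemidirectProduct.inr.comp j₁)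
    ((MulAut.conj (SemidirectProduct.inl l⁻¹)).toMonoidHom.comp (SemidirectProduct.inr.comp j₂)) φ (fun c => ?_)
  · exact congrFun (SemidirectProduct.inl_injective hxy) 1
  · apply SemidirectProduct.ext
    · funext g
      simp only [SemidirectProduct.mul_left, SemidirectProduct.left_inl, Pi.mul_apply, hmul,
        SemidirectProduct.right_inl, MonoidHom.comp_apply, map_one, MulAut.one_apply,
        Pi.constMonoidHom_apply, Function.const_apply]
      exact mul_comm _ _
    · simp
  · have e : j₂ (i₂ c) = j₁ (i₁ c) := (DFunLike.congr_fun h.comm c).symm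
    have hl' := hl c⁻¹
    simp only [MonoidHom.comp_apply, map_inv] at hl'
    apply SemidirectProduct.ext
    · funext g
      simp [-mulAutArrow_apply_apply, -mulAutArrow_apply_symm_apply, e, hl', hmul]
    · simp [e]

/-- The cocycle attached to `φ` takes the value `β(∂ b) - α(∂ a) = (β ∘ i₂ - α ∘ i₁)(c) = φ(c)` on
`j₂ b - j₁ a`, and it vanishes on boundaries. -/
theorem IsAmalgam.linearCombination_eq_zero (h : IsAmalgam i₁ i₂ j₁ j₂) {M : Type}
    [AddCommGroup M] (φ : C →* Multiplicative M) {a : A × A →₀ ℤ} {b : B × B →₀ ℤ} {c : C →₀ ℤ}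
    (ha : bdry₂ A a = chain₁ i₁ c) (hb : bdry₂ B b = chain₁ i₂ c)
    (hz : chain₂ j₂ b - chain₂ j₁ a ∈ groupHomology.boundaries₂ (trivZ G)) :
    Finsupp.linearCombination ℤ (fun x => (φ x).toAdd) c = 0 := by
  obtain ⟨f, α, β, hf, hα, hβ, hφ⟩ := h.exists_cocycle φ
  have e := linearCombination_eq_zero_of_mem_boundaries₂ f hf hz
  rw [map_sub, linearCombination_chain₂, linearCombination_chain₂] at e
  simp only [hα, hβ] at e
  rw [← linearCombination_bdry₂, ← linearCombination_bdry₂, ha, hb, linearCombination_chain₁,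
    linearCombination_chain₁] at e
  rw [← e]
  simp only [Finsupp.linearCombination_apply, Finsupp.sum, ← Finset.sum_sub_distrib, ← smul_sub,
    Function.comp_apply, hφ]

end Connecting


/-! ### Extension of homomorphisms to injective groups -/

section Extension

variable {X Y M : Type} [AddCommGroup X] [AddCommGroup Y] [AddCommGroup M]

/-- A homomorphism to an injective group which vanishes on the kernel of `f` factors through
`f`. -/
theorem exists_comp_eq_of_ker_le (hM : Module.Baer ℤ M) (f : X →+ Y) (g : X →+ M)
    (h : f.ker ≤ g.ker) : ∃ k : Y →+ M, ∀ x, k (f x) = g x := by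
  obtain ⟨k, hk⟩ := hM.extension_property_addMonoidHom (QuotientAddGroup.kerLift f)
    (QuotientAddGroup.kerLift_injective f) (QuotientAddGroup.lift f.ker g h)
  exact ⟨k, fun x => DFunLike.congr_fun hk (x : X ⧸ f.ker)⟩

end Extension

theorem single_d₃₂_mem_boundaries₂ {G : Type} [Group G] (g h k : G) :
    (Finsupp.single (h, k) 1 - Finsupp.single (g * h, k) 1 + Finsupp.single (g, h * k) 1 -
      Finsupp.single (g, h) 1 : G × G →₀ ℤ) ∈ groupHomology.boundaries₂ (trivZ G) :=
  ⟨Finsupp.single (g, h, k) (1 : ℤ), groupHomology.d₃₂_single (A := trivZ G) (g, h, k) (1 : ℤ)⟩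

/-! ### The connecting homomorphism of an amalgam -/

section Connecting

variable {C A B G : Type} [Group C] [Group A] [Group B] [Group G]
  {i₁ : C →* A} {i₂ : C →* B} {j₁ : A →* G} {j₂ : B →* G}

section Twist

variable {M : Type} [AddCommGroup M]

/-- The action of `A` on `M × G` by a homomorphism `j : A → G`, twisted by a 2-cocycle of `G`
whose restriction along `j` is the coboundary of `α`. -/
def twistedEnd (f : G → G → M) (hf : ∀ g h k, f h k + f g (h * k) = f g h + f (g * h) k)
    (j : A →* G) (α : A → M) (hα : ∀ x y, f (j x) (j y) = α y - α (x * y) + α x) :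
    A →* Function.End (M × G) where
  toFun x := fun v => (v.1 - α x + f (j x) v.2, j x * v.2)
  map_one' := by
    funext ⟨m, g⟩
    -- The cocycle need not be normalized: `f 1 g = f 1 1 = α 1`, so the two corrections cancel.
    have h1 := hf 1 1 g
    have h2 := hα 1 1
    simp only [one_mul, map_one, sub_self, zero_add] at h1 h2
    have h3 := add_right_cancel h1
    simp only [map_one, one_mul, h3, h2, sub_add_cancel]
    rfl
  map_mul' x y := by
    funext ⟨m, g⟩
    have h1 := hf (j x) (j y) g
    rw [hα] at h1
    change (_, _) = ((m - α y + f (j y) g) - α x + f (j x) (j y * g), j x * (j y * g))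
    rw [map_mul, mul_assoc, Prod.mk.injEq]
    refine ⟨?_, rfl⟩
    rw [show m - α y + f (j y) g - α x + f (j x) (j y * g) =
      m - α y - α x + (f (j y) g + f (j x) (j y * g)) by abel, h1]
    abel

/-- A 2-cocycle of an amalgam which is a coboundary on the factors, by cochains which agree on the
common subgroup, is a coboundary. -/
theorem IsAmalgam.exists_coboundary (h : IsAmalgam i₁ i₂ j₁ j₂) (f : G → G → M)
    (hf : ∀ g h k, f h k + f g (h * k) = f g h + f (g * h) k) (α : A → M) (β : B → M)
    (hα : ∀ x y, f (j₁ x) (j₁ y) = α y - α (x * y) + α x)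
    (hβ : ∀ x y, f (j₂ x) (j₂ y) = β y - β (x * y) + β x)
    (hαβ : ∀ c, α (i₁ c) = β (i₂ c)) :
    ∃ η : G → M, ∀ x y, f x y = η y - η (x * y) + η x := by
  obtain ⟨q, hq₁, hq₂⟩ := h.exists_hom (Function.End (M × G)) (twistedEnd f hf j₁ α hα)
    (twistedEnd f hf j₂ β hβ) (by
      ext1 c
      funext v
      have e : j₂ (i₂ c) = j₁ (i₁ c) := (DFunLike.congr_fun h.comm c).symm
      change (v.1 - α (i₁ c) + f (j₁ (i₁ c)) v.2, j₁ (i₁ c) * v.2) =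
        (v.1 - β (i₂ c) + f (j₂ (i₂ c)) v.2, j₂ (i₂ c) * v.2)
      rw [hαβ, e])
  have hmul (x y : G) (v : M × G) : q (x * y) v = q x (q y v) := by rw [map_mul]; rfl
  -- Elements acting by the twisted formula for some constant `e`. The factors lie in `S` with `e`
  -- given by `α` and `β`, so `S` is everything, and these constants form the cochain `η`.
  let S : Subgroup G :=
    { carrier := {g | ∃ e : M, ∀ v, q g v = (v.1 - e + f g v.2, g * v.2)}
      one_mem' := by
        refine ⟨f 1 1, fun v => ?_⟩
        have h1 := hf 1 1 v.2
        simp only [one_mul] at h1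
        rw [← add_right_cancel h1, map_one, sub_add_cancel, one_mul]
        rfl
      mul_mem' := by
        rintro x y ⟨e, he⟩ ⟨e', he'⟩
        refine ⟨e + e' - f x y, fun v => ?_⟩
        rw [hmul, he', he]
        refine Prod.ext ?_ (mul_assoc _ _ _).symm
        change v.1 - e' + f y v.2 - e + f x (y * v.2) = v.1 - (e + e' - f x y) + f (x * y) v.2
        rw [show v.1 - e' + f y v.2 - e + f x (y * v.2) =
          v.1 - e' - e + (f y v.2 + f x (y * v.2)) by abel, hf]
        abel
      inv_mem' := by
        rintro x ⟨e, he⟩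
        refine ⟨f x x⁻¹ + f 1 1 - e, fun v => ?_⟩
        have h1 := hf 1 1 v.2
        have h2 := hf x x⁻¹ v.2
        simp only [one_mul, mul_inv_cancel] at h1 h2
        rw [add_right_cancel h1] at h2
        have h3 : v = q x (v.1 + e - f x (x⁻¹ * v.2), x⁻¹ * v.2) := by
          rw [he]
          refine Prod.ext ?_ (mul_inv_cancel_left _ _).symm
          dsimp only
          abel
        conv_lhs => rw [h3]
        rw [← hmul, inv_mul_cancel, map_one]
        refine Prod.ext ?_ rfl
        change v.1 + e - f x (x⁻¹ * v.2) = v.1 - (f x x⁻¹ + f 1 1 - e) + f x⁻¹ v.2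
        rw [← h2]
        abel }
  have hS : S = ⊤ := by
    rw [eq_top_iff, ← h.sup_range, sup_le_iff]
    constructor
    · rintro _ ⟨x, rfl⟩
      exact ⟨α x, fun v => congrFun (DFunLike.congr_fun hq₁ x) v⟩
    · rintro _ ⟨x, rfl⟩
      exact ⟨β x, fun v => congrFun (DFunLike.congr_fun hq₂ x) v⟩
  choose η hη using fun g => (hS ▸ Subgroup.mem_top g : g ∈ S)
  refine ⟨η, fun x y => ?_⟩
  -- Comparing the actions of `x * y` and of `x` after `y` on one point gives the coboundary
  -- relation for `η`.
  have e := congrArg Prod.fst (hmul x y (0, 1))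
  simp only [hη, mul_one] at e
  have h1 := hf x y 1
  simp only [mul_one] at h1
  rw [← add_left_inj (f (x * y) 1), ← h1]
  rw [← sub_eq_zero] at e ⊢
  rw [← neg_eq_zero, ← e]
  abel

end Twist

theorem IsAmalgam.chain_cycle (h : IsAmalgam i₁ i₂ j₁ j₂) {a : A × A →₀ ℤ} {b : B × B →₀ ℤ}
    {c : C →₀ ℤ} (ha : bdry₂ A a = chain₁ i₁ c) (hb : bdry₂ B b = chain₁ i₂ c) :
    chain₂ j₂ b - chain₂ j₁ a ∈ groupHomology.cycles₂ (trivZ G) := by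
  change bdry₂ G _ = 0
  rw [map_sub, bdry₂_chain₂, bdry₂_chain₂, ha, hb, sub_eq_zero]
  have e (j : B →* G) (i : C →* B) : chain₁ j (chain₁ i c) = chain₁ (j.comp i) c :=
    Finsupp.mapDomain_comp.symm
  have e' (j : A →* G) (i : C →* A) : chain₁ j (chain₁ i c) = chain₁ (j.comp i) c :=
    Finsupp.mapDomain_comp.symm
  rw [e, e', h.comm]

/-- If `x` were outside the domain `D` of the relation, a character would kill `D` but not `x`.
Represented by a cocycle, that character turns out to be a coboundary. -/
theorem IsAmalgam.exists_mem_graph_left (h : IsAmalgam i₁ i₂ j₁ j₂) (x : HZ G 2) :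
    ∃ y, (x, y) ∈ mayerVietorisGraph i₁ i₂ j₁ j₂ := by
  let D : AddSubgroup (HZ G 2) :=
    (mayerVietorisGraph i₁ i₂ j₁ j₂).map (AddMonoidHom.fst (HZ G 2) (HZ C 1))
  suffices hx : x ∈ D by
    obtain ⟨⟨x, y⟩, hxy, rfl⟩ := hx
    exact ⟨y, hxy⟩
  by_contra hx
  obtain ⟨χ₀, hχ₀⟩ := CharacterModule.exists_character_apply_ne_zero_of_ne_zero
    (a := (x : HZ G 2 ⧸ D)) (mt (QuotientAddGroup.eq_zero_iff x).1 hx)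
  -- This is `ℚ/ℤ`, which is divisible and hence injective; thus `χ` extends from cycles to a
  -- function `F` on all 2-chains.
  let M := AddCircle (1 : ℚ)
  have hM : Module.Baer ℤ M := Module.Baer.of_divisible _
  let χ : HZ G 2 →+ M := AddMonoidHom.comp χ₀ (QuotientAddGroup.mk' D)
  have hχx : χ x ≠ 0 := hχ₀
  have hχD (y : HZ G 2) (hy : y ∈ D) : χ y = 0 := by
    change χ₀ (y : HZ G 2 ⧸ D) = 0
    rw [(QuotientAddGroup.eq_zero_iff y).2 hy, map_zero]
  obtain ⟨F, hF⟩ := exists_comp_eq_of_ker_le hM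
    (groupHomology.cycles₂ (trivZ G)).subtype.toAddMonoidHom
    (χ.comp (groupHomology.H2π (trivZ G)).hom.toAddMonoidHom) (by
      intro z hz
      have : z = 0 := Subtype.ext hz
      rw [this]
      exact zero_mem _)
  -- The cycle of a zigzag has its class in `D`, where `χ` vanishes. For `c = 0` this says that `F`
  -- vanishes on the cycles of each factor, and so factors through the boundary there as `α₀`,
  -- respectively `β₀`.
  have hF0 {a : A × A →₀ ℤ} {b : B × B →₀ ℤ} {c : C →₀ ℤ} (ha : bdry₂ A a = chain₁ i₁ c)
      (hb : bdry₂ B b = chain₁ i₂ c) : F (chain₂ j₂ b) = F (chain₂ j₁ a) := by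
    rw [← sub_eq_zero, ← map_sub]
    refine (hF ⟨_, h.chain_cycle ha hb⟩).trans (hχD _ ?_)
    exact ⟨(_, _), ⟨a, b, ⟨c, mem_cycles₁_trivZ c⟩, ⟨_, h.chain_cycle ha hb⟩, ha, hb, rfl, rfl,
      rfl⟩, rfl⟩
  obtain ⟨α₀, hα₀⟩ := exists_comp_eq_of_ker_le hM (bdry₂ A).toAddMonoidHom
    (F.comp (chain₂ j₁).toAddMonoidHom) (fun a ha => by
      have := hF0 (a := a) (b := 0) (c := 0) (by rw [map_zero]; exact ha) (by simp)
      rw [map_zero, map_zero] at this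
      exact this.symm)
  obtain ⟨β₀, hβ₀⟩ := exists_comp_eq_of_ker_le hM (bdry₂ B).toAddMonoidHom
    (F.comp (chain₂ j₂).toAddMonoidHom) (fun b hb => by
      have := hF0 (a := 0) (b := b) (c := 0) (by simp) (by rw [map_zero]; exact hb)
      rw [map_zero, map_zero] at this
      exact this)
  let RA := (bdry₂ A).toAddMonoidHom.range
  let RB := (bdry₂ B).toAddMonoidHom.range
  -- `α₀ ∘ i₁ - β₀ ∘ i₂` vanishes on the `c` whose two images are boundaries, so it factors through
  -- chains modulo boundaries as `k`. Distributing `k` over the two cochains makes them agree on `C`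
  -- and leaves their values on boundaries unchanged.
  obtain ⟨k, hk⟩ := exists_comp_eq_of_ker_le hM
    (((QuotientAddGroup.mk' RA).comp (chain₁ i₁).toAddMonoidHom).prod
      ((QuotientAddGroup.mk' RB).comp (chain₁ i₂).toAddMonoidHom))
    (α₀.comp (chain₁ i₁).toAddMonoidHom - β₀.comp (chain₁ i₂).toAddMonoidHom) (fun c hc => by
      obtain ⟨a, ha⟩ := (QuotientAddGroup.eq_zero_iff _).1 (congrArg Prod.fst hc)
      obtain ⟨b, hb⟩ := (QuotientAddGroup.eq_zero_iff _).1 (congrArg Prod.snd hc)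
      change α₀ (chain₁ i₁ c) - β₀ (chain₁ i₂ c) = 0
      have e₁ := hα₀ a
      have e₂ := hβ₀ b
      rw [ha] at e₁
      rw [hb] at e₂
      rw [sub_eq_zero]
      exact e₁.trans ((hF0 ha hb).symm.trans e₂.symm))
  let α₁ : (A →₀ ℤ) →+ M :=
    α₀ - k.comp ((AddMonoidHom.inl _ _).comp (QuotientAddGroup.mk' RA))
  let β₁ : (B →₀ ℤ) →+ M :=
    β₀ + k.comp ((AddMonoidHom.inr _ _).comp (QuotientAddGroup.mk' RB))
  have hα₁ (a : A × A →₀ ℤ) : α₁ (bdry₂ A a) = F (chain₂ j₁ a) := by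
    refine Eq.trans ?_ (hα₀ a)
    have : ((bdry₂ A a : A →₀ ℤ) : (A →₀ ℤ) ⧸ RA) = 0 :=
      (QuotientAddGroup.eq_zero_iff _).2 ⟨a, rfl⟩
    change α₀ (bdry₂ A a) - k (((bdry₂ A a : A →₀ ℤ) : (A →₀ ℤ) ⧸ RA), 0) = α₀ (bdry₂ A a)
    rw [this, ← Prod.zero_eq_mk, map_zero, sub_zero]
  have hβ₁ (b : B × B →₀ ℤ) : β₁ (bdry₂ B b) = F (chain₂ j₂ b) := by
    refine Eq.trans ?_ (hβ₀ b)
    have : ((bdry₂ B b : B →₀ ℤ) : (B →₀ ℤ) ⧸ RB) = 0 :=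
      (QuotientAddGroup.eq_zero_iff _).2 ⟨b, rfl⟩
    change β₀ (bdry₂ B b) + k (0, ((bdry₂ B b : B →₀ ℤ) : (B →₀ ℤ) ⧸ RB)) = β₀ (bdry₂ B b)
    rw [this, ← Prod.zero_eq_mk, map_zero, add_zero]
  have hαβ (c : C →₀ ℤ) : α₁ (chain₁ i₁ c) = β₁ (chain₁ i₂ c) := by
    have e : k (((chain₁ i₁ c : A →₀ ℤ) : (A →₀ ℤ) ⧸ RA),
        ((chain₁ i₂ c : B →₀ ℤ) : (B →₀ ℤ) ⧸ RB)) = α₀ (chain₁ i₁ c) - β₀ (chain₁ i₂ c) := hk c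
    change α₀ (chain₁ i₁ c) - k (((chain₁ i₁ c : A →₀ ℤ) : (A →₀ ℤ) ⧸ RA), 0) =
      β₀ (chain₁ i₂ c) + k (0, ((chain₁ i₂ c : B →₀ ℤ) : (B →₀ ℤ) ⧸ RB))
    rw [sub_eq_iff_eq_add, add_assoc, ← map_add, Prod.mk_add_mk, zero_add, add_zero, e]
    abel
  let f (g g' : G) : M := F (Finsupp.single (g, g') 1)
  have hf (g g' l : G) : f g' l + f g (g' * l) = f g g' + f (g * g') l := by
    have hb := single_d₃₂_mem_boundaries₂ g g' l
    have e := hF ⟨_, groupHomology.boundaries₂_le_cycles₂ _ hb⟩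
    have e' : groupHomology.H2π (trivZ G) ⟨_, groupHomology.boundaries₂_le_cycles₂ _ hb⟩ = 0 :=
      (groupHomology.H2π_eq_zero_iff _).2 hb
    have e'' := e.trans ((congrArg χ e').trans (map_zero χ))
    change F (_ - _ + _ - _) = 0 at e''
    rw [map_sub, map_add, map_sub] at e''
    rw [← sub_eq_zero, ← e'']
    simp only [f]
    abel
  obtain ⟨η, hη⟩ := h.exists_coboundary f hf (fun x => α₁ (Finsupp.single x 1))
    (fun x => β₁ (Finsupp.single x 1))
    (fun x y => by
      have e := hα₁ (Finsupp.single (x, y) 1)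
      rw [chain₂_single, bdry₂_single, map_add, map_sub] at e
      exact e.symm)
    (fun x y => by
      have e := hβ₁ (Finsupp.single (x, y) 1)
      rw [chain₂_single, bdry₂_single, map_add, map_sub] at e
      exact e.symm)
    (fun c => by
      have e := hαβ (Finsupp.single c 1)
      rwa [chain₁_single, chain₁_single] at e)
  have hFη : F = ((Finsupp.linearCombination ℤ η) ∘ₗ bdry₂ G).toAddMonoidHom := by
    apply Finsupp.addHom_ext'
    rintro ⟨g, g'⟩
    ext
    refine (hη g g').trans ?_
    simp [bdry₂_single]
  obtain ⟨z, rfl⟩ : ∃ z, groupHomology.H2π (trivZ G) z = x :=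
    groupHomology.H2_induction_on x fun z => ⟨z, rfl⟩
  apply hχx
  refine (hF z).symm.trans ?_
  have hz : bdry₂ G z.1 = 0 := z.2
  rw [hFη]
  change Finsupp.linearCombination ℤ η (bdry₂ G z.1) = 0
  rw [hz, map_zero]

/-- The universal coefficient homomorphism `C → H_1(C, ℤ)` detects every class, so testing against
it suffices. -/
theorem IsAmalgam.eq_zero_of_mem_graph (h : IsAmalgam i₁ i₂ j₁ j₂) {y : HZ C 1}
    (hy : (0, y) ∈ mayerVietorisGraph i₁ i₂ j₁ j₂) : y = 0 := by
  obtain ⟨a, b, c, z, ha, hb, hz, hz0, rfl⟩ := hy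
  have hz' := (groupHomology.H2π_eq_zero_iff z).1 hz0
  rw [hz] at hz'
  exact (linearCombination_toHZOne (AddMonoidHom.id (HZ C 1)) c).symm.trans
    (h.linearCombination_eq_zero (toHZOne C) ha hb hz')

/-- The connecting homomorphism of the Mayer–Vietoris sequence of an amalgam. -/
theorem IsAmalgam.exists_connecting (h : IsAmalgam i₁ i₂ j₁ j₂) :
    ∃ conn : HZ G 2 →+ HZ C 1, conn.graph = mayerVietorisGraph i₁ i₂ j₁ j₂ := by
  obtain ⟨conn, hconn⟩ := AddSubgroup.exists_eq_graph (G := mayerVietorisGraph i₁ i₂ j₁ j₂) (by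
    constructor
    · rintro ⟨⟨x, y⟩, hxy⟩ ⟨⟨x', y'⟩, hxy'⟩ (rfl : x = x')
      have e := h.eq_zero_of_mem_graph (y := y - y') (by
        have := sub_mem hxy hxy'
        rwa [Prod.mk_sub_mk, sub_self] at this)
      rw [sub_eq_zero] at e
      subst e
      rfl
    · intro x
      obtain ⟨y, hy⟩ := h.exists_mem_graph_left x
      exact ⟨⟨(x, y), hy⟩, rfl⟩)
  exact ⟨conn, hconn.symm⟩

end Connecting


/-! ### Recognizing an amalgam by its reduced words -/

/-- A pushout criterion: nonempty reduced words do not evaluate to elements of the common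
subgroup. -/
theorem isAmalgam_of_reduced_words {C A G : Type} [Group C] [Group A] [Group G]
    (i : Bool → C →* A) (j : Bool → A →* G)
    (hcomm : (j true).comp (i true) = (j false).comp (i false))
    (hi : ∀ b, Function.Injective (i b)) (hj : Function.Injective (j true))
    (hgen : (j true).range ⊔ (j false).range = ⊤)
    (hw : ∀ w : List (Σ _ : Bool, A), w ≠ [] → (∀ x ∈ w, x.2 ∉ (i x.1).range) →
      w.IsChain (fun x y => x.1 ≠ y.1) →
      ∀ c, (w.map fun x => j x.1 x.2).prod ≠ j true (i true c)) :
    IsAmalgam (i true) (i false) (j true) (j false) := by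
  have hinj : Function.Injective ((j true).comp (i true)) := hj.comp (hi true)
  have hjk (b : Bool) : (j b).comp (i b) = (j true).comp (i true) := by
    cases b
    · exact hcomm.symm
    · rfl
  let Φ : Monoid.PushoutI i →* G := Monoid.PushoutI.lift j ((j true).comp (i true)) hjk
  have hΦ (b : Bool) (x : A) : Φ (Monoid.PushoutI.of b x) = j b x :=
    Monoid.PushoutI.lift_of _ _ _ _
  have hΦs : Function.Surjective Φ := by
    rw [← MonoidHom.range_eq_top, eq_top_iff, ← hgen, sup_le_iff]
    constructor
    · rintro _ ⟨x, rfl⟩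
      exact ⟨_, hΦ true x⟩
    · rintro _ ⟨x, rfl⟩
      exact ⟨_, hΦ false x⟩
  have hΦi : Function.Injective Φ := by
    classical
    rw [injective_iff_map_eq_one]
    intro x hx
    -- A kernel element in normal form is a head in `C` times a reduced word. If the word is
    -- nonempty, its value is the image of the inverse of the head, which `hw` forbids.
    obtain ⟨d⟩ := Monoid.PushoutI.NormalWord.transversal_nonempty i hi
    obtain ⟨w, rfl⟩ : ∃ w : Monoid.PushoutI.NormalWord d, w.prod = x :=
      ⟨_, Monoid.PushoutI.NormalWord.equiv.symm_apply_apply x⟩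
    have hbase (c : C) : Φ (Monoid.PushoutI.base i c) = j true (i true c) :=
      Monoid.PushoutI.lift_base j ((j true).comp (i true)) hjk c
    have hprod : Φ w.prod = j true (i true w.head) * (w.toList.map fun x => j x.1 x.2).prod := by
      rw [Monoid.PushoutI.NormalWord.prod, map_mul, hbase]
      rw [Monoid.CoprodI.Word.prod, map_list_prod, map_list_prod, List.map_map, List.map_map]
      rfl
    rw [hx] at hprod
    by_cases hnil : w.toList = []
    · rw [hnil, List.map_nil, List.prod_nil, mul_one] at hprod
      have hh : w.head = 1 := hinj (hprod.symm.trans (map_one _).symm)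
      rw [Monoid.PushoutI.NormalWord.prod, hh, map_one, one_mul, Monoid.CoprodI.Word.prod, hnil]
      simp
    · refine absurd ?_ (hw w.toList hnil ?_ w.chain_ne w.head⁻¹)
      · rw [map_inv, map_inv]
        exact eq_inv_of_mul_eq_one_right hprod.symm
      · rintro ⟨b, x⟩ hx hr
        apply w.ne_one _ hx
        have hs := w.normalized b x hx
        -- A letter in the image of `C` is also a coset representative, so uniqueness of the
        -- decomposition forces it to be 1.
        have := (d.compl b).1 (a₁ := (⟨x, hr⟩, ⟨1, d.one_mem b⟩))
          (a₂ := (⟨1, one_mem _⟩, ⟨x, hs⟩)) (by simp)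
        exact congrArg (fun y => (y.1 : A)) this
  let e : Monoid.PushoutI i ≃* G := MulEquiv.ofBijective Φ ⟨hΦi, hΦs⟩
  have he (b : Bool) (x : A) : e.symm (j b x) = Monoid.PushoutI.of b x := by
    rw [MulEquiv.symm_apply_eq]
    exact (hΦ b x).symm
  refine ⟨hcomm, hinj, hgen, fun K _ f g hfg => ?_⟩
  let q : Monoid.PushoutI i →* K := Monoid.PushoutI.lift (fun b => cond b f g)
    (f.comp (i true)) (by
      rintro (_ | _)
      · exact hfg.symm
      · rfl)
  have hq (b : Bool) (x : A) : q (Monoid.PushoutI.of b x) = (cond b f g) x :=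
    Monoid.PushoutI.lift_of _ _ _ _
  refine ⟨q.comp e.symm.toMonoidHom, ?_, ?_⟩
  · ext x
    exact (congrArg q (he true x)).trans (hq true x)
  · ext x
    exact (congrArg q (he false x)).trans (hq false x)

/-! ### The `p`-adic norm on `ℤ[1/n]` and on columns -/

section Norm

variable {n p : ℕ} [Fact p.Prime]

theorem padicNorm_natCast_eq_one_of_not_dvd (hpn : ¬ p ∣ n) (r : ℕ) :
    padicNorm p ((n : ℚ) ^ r) = 1 := by
  have := (padicNorm.nat_eq_one_iff (p := p) (n ^ r)).2
    (fun h => hpn ((Fact.out : p.Prime).dvd_of_dvd_pow h))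
  exact_mod_cast this

theorem padicNorm_le_one_of_mem_ZInv (hpn : ¬ p ∣ n) {x : ℚ} (hx : x ∈ ZInv n) :
    padicNorm p x ≤ 1 := by
  obtain ⟨a, r, rfl⟩ := hx
  rw [padicNorm.div, padicNorm_natCast_eq_one_of_not_dvd hpn, div_one]
  exact padicNorm.of_int a

theorem inv_mul_mem_ZInv_of_padicNorm_lt_one (hpn : ¬ p ∣ n) {x : ℚ} (hx : x ∈ ZInv n)
    (h : padicNorm p x < 1) : (p : ℚ)⁻¹ * x ∈ ZInv n := by
  obtain ⟨a, r, rfl⟩ := hx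
  rw [padicNorm.div, padicNorm_natCast_eq_one_of_not_dvd hpn, div_one,
    padicNorm.int_lt_one_iff] at h
  obtain ⟨k, rfl⟩ := h
  have hp : (p : ℚ) ≠ 0 := by exact_mod_cast (Fact.out : p.Prime).ne_zero
  exact ⟨k, r, by push_cast; field_simp⟩

theorem mem_ZInv_of_padicNorm_le_one {x : ℚ} (hx : x ∈ ZInv (p * n)) (h : padicNorm p x ≤ 1) :
    x ∈ ZInv n := by
  obtain ⟨a, r, rfl⟩ := hx
  have hp : (p : ℚ) ≠ 0 := by exact_mod_cast (Fact.out : p.Prime).ne_zero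
  rcases eq_or_ne (n : ℚ) 0 with hn | hn
  · rcases Nat.eq_zero_or_pos r with rfl | hr
    · exact ⟨a, 0, by simp⟩
    · exact ⟨0, 0, by simp [hn, hr.ne']⟩
  have e : padicNorm p a ≤ (p : ℚ) ^ (-r : ℤ) := by
    have e₁ : (a : ℚ) = (a / ((p * n : ℕ) : ℚ) ^ r) * (n : ℚ) ^ r * (p : ℚ) ^ r := by
      push_cast
      rw [mul_assoc, ← mul_pow, mul_comm (n : ℚ), div_mul_cancel₀]
      exact pow_ne_zero r (mul_ne_zero hp hn)
    have e₂ : padicNorm p ((p : ℚ) ^ r) = (p : ℚ) ^ (-r : ℤ) := by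
      rw [padicNorm.eq_zpow_of_nonzero (pow_ne_zero r hp), padicValRat.pow,
        padicValRat.self (Fact.out : p.Prime).one_lt, mul_one]
    have e₃ : padicNorm p ((n : ℚ) ^ r) ≤ 1 := by
      exact_mod_cast padicNorm.of_nat (p := p) (n ^ r)
    rw [e₁, padicNorm.mul, e₂, padicNorm.mul]
    refine mul_le_of_le_one_left (by positivity) ?_
    exact mul_le_one₀ h (padicNorm.nonneg _) e₃
  obtain ⟨k, rfl⟩ := padicNorm.dvd_iff_norm_le.2 e
  refine ⟨k, r, ?_⟩
  push_cast
  rw [mul_pow, mul_div_mul_left _ _ (pow_ne_zero r hp)]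

/-- The term `c * x` strictly dominates, so the ultrametric inequality is sharp. This is the action
of a letter of the first factor outside `Γ_0(n, p)` on a column. -/
theorem padicNorm_step_one {a b c d x y : ℚ} (ha : padicNorm p a ≤ 1) (hb : padicNorm p b ≤ 1)
    (hc : padicNorm p c = 1) (hd : padicNorm p d ≤ 1) (hxy : padicNorm p y < padicNorm p x) :
    padicNorm p (c * x + d * y) = padicNorm p x ∧ padicNorm p (a * x + b * y) ≤ padicNorm p x := by
  have hx := padicNorm.nonneg (p := p) x
  have hy := padicNorm.nonneg (p := p) y
  constructor
  · have h₁ : padicNorm p (c * x) = padicNorm p x := by rw [padicNorm.mul, hc, one_mul]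
    have h₂ : padicNorm p (d * y) < padicNorm p x := by
      rw [padicNorm.mul]
      exact (mul_le_of_le_one_left hy hd).trans_lt hxy
    rw [padicNorm.add_eq_max_of_ne (by rw [h₁]; exact h₂.ne'), h₁, max_eq_left h₂.le]
  · refine padicNorm.nonarchimedean.trans (max_le ?_ ?_)
    · rw [padicNorm.mul]
      exact mul_le_of_le_one_left hx ha
    · rw [padicNorm.mul]
      exact (mul_le_of_le_one_left hy hb).trans hxy.le

/-- The term `p⁻¹ * b * y` strictly dominates. This is the action of a letter of the second factor,
embedded by `j_2'`, outside the image of `i_2'`. -/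
theorem padicNorm_step_two {a b c d x y : ℚ} (ha : padicNorm p a ≤ 1) (hb : padicNorm p b = 1)
    (hc : padicNorm p c ≤ 1) (hd : padicNorm p d ≤ 1) (hxy : padicNorm p x ≤ padicNorm p y)
    (hy0 : 0 < padicNorm p y) :
    padicNorm p (a * x + (p : ℚ)⁻¹ * b * y) = p * padicNorm p y ∧
      padicNorm p (p * c * x + d * y) ≤ padicNorm p y := by
  have hx := padicNorm.nonneg (p := p) x
  have hp : (1 : ℚ) < p := by exact_mod_cast (Fact.out : p.Prime).one_lt
  have hlt : padicNorm p y < p * padicNorm p y := lt_mul_of_one_lt_left hy0 hp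
  constructor
  · have h₁ : padicNorm p ((p : ℚ)⁻¹ * b * y) = p * padicNorm p y := by
      rw [padicNorm.mul, padicNorm.mul, hb, mul_one, inv_eq_one_div, padicNorm.div,
        padicNorm.padicNorm_p_of_prime, padicNorm.one, one_div, inv_inv]
    have h₂ : padicNorm p (a * x) < p * padicNorm p y := by
      rw [padicNorm.mul]
      exact ((mul_le_of_le_one_left hx ha).trans hxy).trans_lt hlt
    rw [padicNorm.add_eq_max_of_ne (by rw [h₁]; exact h₂.ne), h₁, max_eq_right h₂.le]
  · refine padicNorm.nonarchimedean.trans (max_le ?_ ?_)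
    · rw [padicNorm.mul, padicNorm.mul]
      refine (mul_le_of_le_one_left hx ?_).trans hxy
      exact mul_le_one₀ padicNorm.padicNorm_p_lt_one_of_prime.le (padicNorm.nonneg _) hc
    · rw [padicNorm.mul]
      exact mul_le_of_le_one_left hy0.le hd

end Norm

/-! ### Generation of `SL_2(ℤ[1/pn])` by the two factors -/

section Generation

variable {n p : ℕ}

theorem jOne_coe (hp : p ≠ 0) (g : SL2Z n) (i j : Fin 2) :
    ((jOne n p hp g i j : ZInv (p * n)) : ℚ) = g i j := rfl

section

variable (hp : p ≠ 0) (hn : n ≠ 0) (g : SL2Z n)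

theorem jTwo_coe_zero_zero : ((jTwo n p hp hn g 0 0 : ZInv (p * n)) : ℚ) = g 0 0 := rfl

theorem jTwo_coe_zero_one : ((jTwo n p hp hn g 0 1 : ZInv (p * n)) : ℚ) = (p : ℚ)⁻¹ * g 0 1 := rfl

theorem jTwo_coe_one_zero : ((jTwo n p hp hn g 1 0 : ZInv (p * n)) : ℚ) = p * g 1 0 := by
  change (((p : ZInv (p * n)) * Subring.inclusion (ZInv_le_mul hp) (g 1 0) : ZInv (p * n)) : ℚ) = _
  push_cast
  rfl

theorem jTwo_coe_one_one : ((jTwo n p hp hn g 1 1 : ZInv (p * n)) : ℚ) = g 1 1 := rfl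

end

theorem SL2Z_mul_coe {m : ℕ} (x y : SL2Z m) (i j : Fin 2) :
    (((x * y) i j : ZInv m) : ℚ) = x i 0 * y 0 j + x i 1 * y 1 j := by
  rw [SL2_mul_entry]
  push_cast
  rfl

theorem SL2Z_ext {m : ℕ} {x y : SL2Z m} (h : ∀ i j, ((x i j : ZInv m) : ℚ) = y i j) : x = y := by
  ext i j
  exact h i j

theorem SL2Z_det_coe {m : ℕ} (g : SL2Z m) :
    ((g 0 0 : ZInv m) : ℚ) * g 1 1 - g 0 1 * g 1 0 = 1 := by
  have hd := congrArg (fun x : ZInv m => (x : ℚ)) (SL2_det_eq g)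
  push_cast at hd
  exact hd

theorem iOne_injective : Function.Injective (iOne n p) :=
  Subtype.val_injective

theorem iTwo_coe (hp : p ≠ 0) (g : Gamma0 n p) :
    ((iTwo n p hp g 0 0 : ZInv n) : ℚ) = (g : SL2Z n) 0 0 ∧
    ((iTwo n p hp g 0 1 : ZInv n) : ℚ) = p * (g : SL2Z n) 0 1 ∧
    ((iTwo n p hp g 1 0 : ZInv n) : ℚ) = (p : ℚ)⁻¹ * (g : SL2Z n) 1 0 ∧
    ((iTwo n p hp g 1 1 : ZInv n) : ℚ) = (g : SL2Z n) 1 1 := by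
  refine ⟨rfl, ?_, rfl, rfl⟩
  change (((p : ZInv n) * (g : SL2Z n) 0 1 : ZInv n) : ℚ) = _
  push_cast
  rfl

theorem jOne_injective (hp : p ≠ 0) : Function.Injective (jOne n p hp) := by
  intro x y h
  refine SL2Z_ext fun i j => ?_
  rw [← jOne_coe hp, h, jOne_coe]

theorem jOne_comp_iOne (hp : p ≠ 0) (hn : n ≠ 0) :
    (jOne n p hp).comp (iOne n p) = (jTwo n p hp hn).comp (iTwo n p hp) := by
  have hpQ : (p : ℚ) ≠ 0 := by exact_mod_cast hp
  ext1 g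
  obtain ⟨k₁, k₂, k₃, k₄⟩ := iTwo_coe hp g
  refine SL2Z_ext fun i j => ?_
  fin_cases i <;> fin_cases j
  · exact ((jTwo_coe_zero_zero hp hn _).trans k₁).symm
  · refine Eq.symm ((jTwo_coe_zero_one hp hn _).trans ?_)
    rw [k₂, inv_mul_cancel_left₀ hpQ]
    rfl
  · refine Eq.symm ((jTwo_coe_one_zero hp hn _).trans ?_)
    rw [k₃, mul_inv_cancel_left₀ hpQ]
    rfl
  · exact ((jTwo_coe_one_one hp hn _).trans k₄).symm

theorem iTwo_injective (hp : p ≠ 0) (hn : n ≠ 0) : Function.Injective (iTwo n p hp) := by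
  refine Function.Injective.of_comp (f := jTwo n p hp hn) ?_
  rw [← MonoidHom.coe_comp, ← jOne_comp_iOne hp hn]
  exact (jOne_injective hp).comp iOne_injective

/-- The matrix `(a, b; c, d)` with rational entries in `ℤ[1/m]`. -/
def ratSL2 {m : ℕ} (a b c d : ℚ) (ha : a ∈ ZInv m) (hb : b ∈ ZInv m) (hc : c ∈ ZInv m)
    (hd : d ∈ ZInv m) (h : a * d - b * c = 1) : SL2Z m :=
  mkSL2 ⟨a, ha⟩ ⟨b, hb⟩ ⟨c, hc⟩ ⟨d, hd⟩ (Subtype.ext h)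

section

variable {m : ℕ} {a b c d : ℚ} {ha : a ∈ ZInv m} {hb : b ∈ ZInv m} {hc : c ∈ ZInv m}
  {hd : d ∈ ZInv m} {h : a * d - b * c = 1}

theorem ratSL2_coe_zero_zero : ((ratSL2 a b c d ha hb hc hd h 0 0 : ZInv m) : ℚ) = a := rfl

theorem ratSL2_coe_zero_one : ((ratSL2 a b c d ha hb hc hd h 0 1 : ZInv m) : ℚ) = b := rfl

theorem ratSL2_coe_one_zero : ((ratSL2 a b c d ha hb hc hd h 1 0 : ZInv m) : ℚ) = c := rfl

theorem ratSL2_coe_one_one : ((ratSL2 a b c d ha hb hc hd h 1 1 : ZInv m) : ℚ) = d := rfl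

theorem SL2Z_ext_entries {x y : SL2Z m} (h00 : ((x 0 0 : ZInv m) : ℚ) = y 0 0)
    (h01 : ((x 0 1 : ZInv m) : ℚ) = y 0 1) (h10 : ((x 1 0 : ZInv m) : ℚ) = y 1 0)
    (h11 : ((x 1 1 : ZInv m) : ℚ) = y 1 1) : x = y := by
  refine SL2Z_ext fun i j => ?_
  fin_cases i <;> fin_cases j
  exacts [h00, h01, h10, h11]

end

theorem zpow_mem_ZInv (hn : n ≠ 0) (k : ℤ) : (p : ℚ) ^ k ∈ ZInv (p * n) := by
  rcases k with k | k
  · rw [Int.ofNat_eq_natCast, zpow_natCast]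
    exact pow_mem (natCast_mem _ p) k
  · rw [zpow_negSucc, ← inv_pow]
    exact pow_mem (inv_mem_ZInv hn) _

/-- The matrix `(p ^ k, 0; 0, p ^ (-k))`. -/
def diagPow (n p : ℕ) (hp : p ≠ 0) (hn : n ≠ 0) (k : ℤ) : SL2Z (p * n) :=
  ratSL2 ((p : ℚ) ^ k) 0 0 ((p : ℚ) ^ (-k)) (zpow_mem_ZInv hn k) (zero_mem _) (zero_mem _)
    (zpow_mem_ZInv hn _) (by
      have h : (p : ℚ) ≠ 0 := by exact_mod_cast hp
      rw [← zpow_add₀ h]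
      simp)

/-- The elementary matrix `(1, t; 0, 1)`. -/
def upperSL2 {m : ℕ} (t : ℚ) (ht : t ∈ ZInv m) : SL2Z m :=
  ratSL2 1 t 0 1 (one_mem _) ht (zero_mem _) (one_mem _) (by ring)

/-- The subgroup generated by the two copies of `SL_2(ℤ[1/n])` in `SL_2(ℤ[1/pn])`. -/
def jSup (n p : ℕ) (hp : p ≠ 0) (hn : n ≠ 0) : Subgroup (SL2Z (p * n)) :=
  (jOne n p hp).range ⊔ (jTwo n p hp hn).range

theorem jOne_mem_jSup (hp : p ≠ 0) (hn : n ≠ 0) (g : SL2Z n) : jOne n p hp g ∈ jSup n p hp hn :=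
  Subgroup.mem_sup_left ⟨g, rfl⟩

theorem jTwo_mem_jSup (hp : p ≠ 0) (hn : n ≠ 0) (g : SL2Z n) :
    jTwo n p hp hn g ∈ jSup n p hp hn :=
  Subgroup.mem_sup_right ⟨g, rfl⟩

theorem diagPow_add (hp : p ≠ 0) (hn : n ≠ 0) (k l : ℤ) :
    diagPow n p hp hn (k + l) = diagPow n p hp hn k * diagPow n p hp hn l := by
  have h : (p : ℚ) ≠ 0 := by exact_mod_cast hp
  apply SL2Z_ext_entries <;> rw [SL2Z_mul_coe] <;>
    simp only [diagPow, ratSL2_coe_zero_zero, ratSL2_coe_zero_one, ratSL2_coe_one_zero,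
      ratSL2_coe_one_one, mul_zero, zero_mul, add_zero, zero_add, neg_add, zpow_add₀ h]

theorem diagPow_mem_jSup (hp : p ≠ 0) (hn : n ≠ 0) (k : ℤ) :
    diagPow n p hp hn k ∈ jSup n p hp hn := by
  have h : (p : ℚ) ≠ 0 := by exact_mod_cast hp
  have h0 : diagPow n p hp hn 0 = 1 := by
    have := diagPow_add hp hn 0 0
    rwa [add_zero, left_eq_mul] at this
  have h1 : diagPow n p hp hn (-1) ∈ jSup n p hp hn := by
    -- The two embeddings of a Weyl element differ by a diagonal matrix.
    have e : diagPow n p hp hn (-1) =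
        jTwo n p hp hn (ratSL2 0 1 (-1) 0 (zero_mem _) (one_mem _) (neg_mem (one_mem _))
          (zero_mem _) (by ring)) *
        jOne n p hp (ratSL2 0 (-1) 1 0 (zero_mem _) (neg_mem (one_mem _)) (one_mem _)
          (zero_mem _) (by ring)) := by
      apply SL2Z_ext_entries <;> rw [SL2Z_mul_coe] <;>
        simp only [jTwo_coe_zero_zero, jTwo_coe_zero_one, jTwo_coe_one_zero, jTwo_coe_one_one,
          jOne_coe, diagPow, ratSL2_coe_zero_zero, ratSL2_coe_zero_one, ratSL2_coe_one_zero,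
          ratSL2_coe_one_one] <;> simp
    rw [e]
    exact mul_mem (jTwo_mem_jSup hp hn _) (jOne_mem_jSup hp hn _)
  have h2 : diagPow n p hp hn 1 ∈ jSup n p hp hn := by
    have e := diagPow_add hp hn (-1) 1
    rw [neg_add_cancel, h0] at e
    rw [eq_inv_of_mul_eq_one_right e.symm]
    exact inv_mem h1
  induction k with
  | zero => exact h0 ▸ one_mem _
  | succ k ih => exact diagPow_add hp hn k 1 ▸ mul_mem ih h2
  | pred k ih => exact diagPow_add hp hn (-k) (-1) ▸ mul_mem ih h1

theorem upperSL2_mem_jSup (hp : p ≠ 0) (hn : n ≠ 0) {t : ℚ} (ht : t ∈ ZInv (p * n)) :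
    upperSL2 t ht ∈ jSup n p hp hn := by
  have hpQ : (p : ℚ) ≠ 0 := by exact_mod_cast hp
  have hnQ : (n : ℚ) ≠ 0 := by exact_mod_cast hn
  obtain ⟨a, r, h⟩ := id ht
  have ht' : a * p ^ r / (n : ℚ) ^ r ∈ ZInv n := ⟨a * p ^ r, r, by push_cast; rfl⟩
  -- Conjugation by `(p ^ r, 0; 0, p ^ (-r))` multiplies `t` by `p ^ (2r)`, which clears the
  -- `p`-part of its denominator.
  have e : diagPow n p hp hn r * upperSL2 t ht =
      jOne n p hp (upperSL2 _ ht') * diagPow n p hp hn r := by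
    apply SL2Z_ext_entries <;> rw [SL2Z_mul_coe, SL2Z_mul_coe] <;>
      simp only [jOne_coe, diagPow, upperSL2, ratSL2_coe_zero_zero, ratSL2_coe_zero_one,
        ratSL2_coe_one_zero, ratSL2_coe_one_one] <;> simp [h]
    rw [mul_pow]
    field_simp
  rw [eq_inv_mul_of_mul_eq e]
  exact mul_mem (inv_mem (diagPow_mem_jSup hp hn r))
    (mul_mem (jOne_mem_jSup hp hn _) (diagPow_mem_jSup hp hn r))

theorem exists_jOne_mul_lower_eq_zero (hp : p ≠ 0) (hn : n ≠ 0) (g : SL2Z (p * n)) :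
    ∃ s : SL2Z n, (((jOne n p hp s * g) 1 0 : ZInv (p * n)) : ℚ) = 0 := by
  have hpQ : (p : ℚ) ≠ 0 := by exact_mod_cast hp
  have hnQ : (n : ℚ) ≠ 0 := by exact_mod_cast hn
  have hdet := SL2Z_det_coe g
  obtain ⟨a, r, hx⟩ := (g 0 0).2
  obtain ⟨b, s, hy⟩ := (g 1 0).2
  have hN : ((p * n : ℕ) : ℚ) ≠ 0 := by
    push_cast
    exact mul_ne_zero hpQ hnQ
  set N : ℚ := ((p * n : ℕ) : ℚ) with hNdef
  -- The first column over the common denominator `N ^ (r + s)`. Dividing by the gcd leaves a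
  -- primitive integral vector, which a Bézout matrix sends to a multiple of the first basis vector.
  set A : ℤ := a * (p * n : ℕ) ^ s with hA
  set B : ℤ := b * (p * n : ℕ) ^ r with hB
  have hx' : ((g 0 0 : ZInv (p * n)) : ℚ) = A / N ^ (r + s) := by
    rw [hx, hA, pow_add]
    push_cast
    rw [← Nat.cast_mul, ← hNdef]
    field_simp
  have hy' : ((g 1 0 : ZInv (p * n)) : ℚ) = B / N ^ (r + s) := by
    rw [hy, hB, pow_add]
    push_cast
    rw [← Nat.cast_mul, ← hNdef]
    field_simp
  have hpos : 0 < Int.gcd A B := by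
    rw [Int.gcd_pos_iff]
    by_contra! h0
    rw [hx', hy', h0.1, h0.2] at hdet
    simp at hdet
  obtain ⟨A', B', hco, hA', hB'⟩ := Int.exists_gcd_one hpos
  generalize Int.gcd A B = m at hA' hB'
  obtain ⟨u, v, huv⟩ := Int.isCoprime_iff_gcd_eq_one.2 hco
  refine ⟨ratSL2 u v (-B') A' (intCast_mem _ u) (intCast_mem _ v) (neg_mem (intCast_mem _ B'))
    (intCast_mem _ A') (by rw [mul_neg, sub_neg_eq_add]; exact_mod_cast huv), ?_⟩
  rw [SL2Z_mul_coe, jOne_coe, jOne_coe, ratSL2_coe_one_zero, ratSL2_coe_one_one, hx', hy']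
  rw [hA', hB']
  push_cast
  ring

theorem jSup_eq_top [Fact p.Prime] (hp : p ≠ 0) (hn : n ≠ 0) : jSup n p hp hn = ⊤ := by
  have hpQ : (p : ℚ) ≠ 0 := by exact_mod_cast hp
  rw [eq_top_iff]
  rintro g -
  obtain ⟨s, hs⟩ := exists_jOne_mul_lower_eq_zero hp hn g
  set h := jOne n p hp s * g with hh
  suffices hmem : h ∈ jSup n p hp hn from (mul_mem_cancel_left (jOne_mem_jSup hp hn s)).1 hmem
  have hdet := SL2Z_det_coe h
  rw [hs, mul_zero, sub_zero] at hdet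
  obtain ⟨l, hl⟩ : ∃ l : ℚ, ((h 0 0 : ZInv (p * n)) : ℚ) = l := ⟨_, rfl⟩
  obtain ⟨l', hl'⟩ : ∃ l : ℚ, ((h 1 1 : ZInv (p * n)) : ℚ) = l := ⟨_, rfl⟩
  obtain ⟨t, ht⟩ : ∃ l : ℚ, ((h 0 1 : ZInv (p * n)) : ℚ) = l := ⟨_, rfl⟩
  have hlm : l ∈ ZInv (p * n) := hl ▸ (h 0 0).2
  have hlm' : l' ∈ ZInv (p * n) := hl' ▸ (h 1 1).2
  have htm : t ∈ ZInv (p * n) := ht ▸ (h 0 1).2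
  rw [hl, hl'] at hdet
  have hl0 : l ≠ 0 := left_ne_zero_of_mul_eq_one hdet
  -- Removing `p ^ z` from the diagonal leaves `p`-adic units, so the remaining diagonal matrix
  -- comes from `SL_2(ℤ[1/n])`.
  obtain ⟨z, hz⟩ := padicNorm.values_discrete (p := p) hl0
  have hpz (k : ℤ) : padicNorm p ((p : ℚ) ^ k) = (p : ℚ) ^ (-k) := by
    rw [padicNorm.eq_zpow_of_nonzero (zpow_ne_zero k hpQ), padicValRat.zpow,
      padicValRat.self (Fact.out : p.Prime).one_lt, mul_one]
  have hμ : (p : ℚ) ^ (-z) * l ∈ ZInv n := by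
    refine mem_ZInv_of_padicNorm_le_one (mul_mem (zpow_mem_ZInv hn _) hlm) ?_
    rw [padicNorm.mul, hpz, hz, ← zpow_add₀ hpQ]
    simp
  have hμ' : (p : ℚ) ^ z * l' ∈ ZInv n := by
    refine mem_ZInv_of_padicNorm_le_one (mul_mem (zpow_mem_ZInv hn _) hlm') ?_
    have e : padicNorm p l * padicNorm p l' = 1 := by rw [← padicNorm.mul, hdet, padicNorm.one]
    rw [padicNorm.mul, hpz, ← hz, e]
  have hcancel : (p : ℚ) ^ z * (p : ℚ) ^ (-z) = 1 := by
    rw [← zpow_add₀ hpQ]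
    simp
  have e : h = diagPow n p hp hn z *
      (jOne n p hp (ratSL2 _ 0 0 _ hμ (zero_mem _) (zero_mem _) hμ' (by
        linear_combination l * l' * hcancel + hdet)) *
      upperSL2 (l' * t) (mul_mem hlm' htm)) := by
    apply SL2Z_ext_entries <;> simp only [SL2Z_mul_coe, jOne_coe, diagPow, upperSL2,
      ratSL2_coe_zero_zero, ratSL2_coe_zero_one, ratSL2_coe_one_zero, ratSL2_coe_one_one]
    · rw [hl]
      linear_combination (-l) * hcancel
    · rw [ht]
      linear_combination (-t * l * l') * hcancel - t * hdet
    · rw [hs]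
      ring
    · rw [hl']
      linear_combination (-l') * hcancel
  rw [e]
  exact mul_mem (diagPow_mem_jSup hp hn z)
    (mul_mem (jOne_mem_jSup hp hn _) (upperSL2_mem_jSup hp hn _))

end Generation




/-! ### Ping-pong for reduced words -/

section Words

variable {n p : ℕ} [Fact p.Prime]

theorem padicNorm_SL2Z_le_one (hpn : ¬ p ∣ n) (g : SL2Z n) (i j : Fin 2) :
    padicNorm p (g i j : ZInv n) ≤ 1 :=
  padicNorm_le_one_of_mem_ZInv hpn (g i j).2

theorem padicNorm_lower_of_notMem_range_iOne (hpn : ¬ p ∣ n) {g : SL2Z n}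
    (hg : g ∉ (iOne n p).range) : padicNorm p (g 1 0 : ZInv n) = 1 := by
  refine le_antisymm (padicNorm_SL2Z_le_one hpn g 1 0) (not_lt.1 fun h => hg ?_)
  have hpQ : (p : ℚ) ≠ 0 := by exact_mod_cast (Fact.out : p.Prime).ne_zero
  refine ⟨⟨g, ⟨_, inv_mul_mem_ZInv_of_padicNorm_lt_one hpn (g 1 0).2 h⟩, ?_⟩, rfl⟩
  ext
  push_cast
  rw [mul_inv_cancel_left₀ hpQ]

theorem padicNorm_upper_of_notMem_range_iTwo (hp : p ≠ 0) (hpn : ¬ p ∣ n) {g : SL2Z n}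
    (hg : g ∉ (iTwo n p hp).range) : padicNorm p (g 0 1 : ZInv n) = 1 := by
  refine le_antisymm (padicNorm_SL2Z_le_one hpn g 0 1) (not_lt.1 fun h => hg ?_)
  have hpQ : (p : ℚ) ≠ 0 := by exact_mod_cast hp
  have hp10 : (p : ℚ) * (g 1 0 : ZInv n) ∈ ZInv n := mul_mem (natCast_mem _ p) (g 1 0).2
  have hdet := SL2Z_det_coe g
  let s : SL2Z n := ratSL2 (g 0 0 : ZInv n) ((p : ℚ)⁻¹ * (g 0 1 : ZInv n))
    (p * (g 1 0 : ZInv n)) (g 1 1 : ZInv n) (g 0 0).2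
    (inv_mul_mem_ZInv_of_padicNorm_lt_one hpn (g 0 1).2 h) hp10 (g 1 1).2 (by
      rw [← hdet]
      field_simp)
  refine ⟨⟨s, ⟨g 1 0, ?_⟩⟩, ?_⟩
  · ext
    push_cast
    rfl
  · obtain ⟨k₁, k₂, k₃, k₄⟩ := iTwo_coe hp (⟨s, ⟨g 1 0, by ext; push_cast; rfl⟩⟩ : Gamma0 n p)
    refine SL2Z_ext_entries k₁ (k₂.trans ?_) (k₃.trans ?_) k₄
    · exact mul_inv_cancel_left₀ hpQ _
    · exact inv_mul_cancel_left₀ hpQ _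

/-- The two embeddings of `Γ_0(n, p)`. -/
def iBool (n p : ℕ) (hp : p ≠ 0) (b : Bool) : Gamma0 n p →* SL2Z n :=
  cond b (iOne n p) (iTwo n p hp)

/-- The two embeddings of `SL_2(ℤ[1/n])`. -/
def jBool (n p : ℕ) (hp : p ≠ 0) (hn : n ≠ 0) (b : Bool) : SL2Z n →* SL2Z (p * n) :=
  cond b (jOne n p hp) (jTwo n p hp hn)

/-- The `p`-adic norms of one of the columns of the value of a reduced word. -/
theorem padicNorm_column_of_reduced (hp : p ≠ 0) (hn : n ≠ 0) (hpn : ¬ p ∣ n) (b : Bool)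
    (g : SL2Z n) (w : List (Σ _ : Bool, SL2Z n))
    (hr : ∀ x ∈ (⟨b, g⟩ : Σ _ : Bool, SL2Z n) :: w, x.2 ∉ (iBool n p hp x.1).range)
    (hw : ((⟨b, g⟩ : Σ _ : Bool, SL2Z n) :: w).IsChain (fun x y => x.1 ≠ y.1)) :
    ∃ (k : Fin 2) (x y : ℚ),
      ((((jBool n p hp hn b g * (w.map fun x => jBool n p hp hn x.1 x.2).prod) 0 k :
        ZInv (p * n)) : ℚ) = x) ∧
      ((((jBool n p hp hn b g * (w.map fun x => jBool n p hp hn x.1 x.2).prod) 1 k :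
        ZInv (p * n)) : ℚ) = y) ∧
      cond b (1 ≤ padicNorm p y ∧ padicNorm p x ≤ padicNorm p y ∧ (w ≠ [] → 1 < padicNorm p y))
        (1 < padicNorm p x ∧ padicNorm p y < padicNorm p x) := by
  have hN := padicNorm_SL2Z_le_one (p := p) hpn g
  have hg := hr _ List.mem_cons_self
  have hp1 : (1 : ℚ) < p := by exact_mod_cast (Fact.out : p.Prime).one_lt
  induction w generalizing b g with
  | nil =>
    cases b
    -- The rightmost letter decides which column to follow: the one containing its entry known to
    -- have norm 1.
    · refine ⟨1, _, _, rfl, rfl, ?_⟩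
      have h := padicNorm_upper_of_notMem_range_iTwo hp hpn hg
      simp only [List.map_nil, List.prod_nil, mul_one, cond_false, jBool, jTwo_coe_zero_one,
        jTwo_coe_one_one]
      have h' : padicNorm p ((p : ℚ)⁻¹ * (g 0 1 : ZInv n)) = p := by
        rw [padicNorm.mul, h, mul_one, inv_eq_one_div, padicNorm.div,
          padicNorm.padicNorm_p_of_prime, padicNorm.one, one_div, inv_inv]
      rw [h']
      exact ⟨hp1, (hN 1 1).trans_lt hp1⟩
    · refine ⟨0, _, _, rfl, rfl, ?_⟩
      have h := padicNorm_lower_of_notMem_range_iOne hpn hg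
      simp only [List.map_nil, List.prod_nil, mul_one, cond_true, jBool, jOne_coe]
      rw [h]
      exact ⟨le_rfl, hN 0 0, fun h => absurd rfl h⟩
  | cons a w ih =>
    obtain ⟨b', g'⟩ := a
    rw [List.isChain_cons_cons] at hw
    have hr' : ∀ x ∈ (⟨b', g'⟩ : Σ _ : Bool, SL2Z n) :: w, x.2 ∉ (iBool n p hp x.1).range :=
      fun x hx => hr x (List.mem_cons_of_mem _ hx)
    obtain ⟨k, x, y, hx, hy, hxy⟩ := ih b' g' hr' hw.2 (padicNorm_SL2Z_le_one (p := p) hpn g')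
      (hr' _ List.mem_cons_self)
    refine ⟨k, _, _, rfl, rfl, ?_⟩
    simp only [List.map_cons, List.prod_cons, SL2Z_mul_coe _ (jBool n p hp hn b' g' * _), hx, hy]
    cases b
    · obtain rfl : b' = true := by simpa using hw.1
      simp only [cond_true] at hxy
      have hy0 : 0 < padicNorm p y := zero_lt_one.trans_le hxy.1
      obtain ⟨h₁, h₂⟩ := padicNorm_step_two (hN 0 0)
        (padicNorm_upper_of_notMem_range_iTwo hp hpn hg) (hN 1 0) (hN 1 1) hxy.2.1 hy0
      simp only [cond_false, jBool, jTwo_coe_zero_zero, jTwo_coe_zero_one, jTwo_coe_one_zero,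
        jTwo_coe_one_one]
      rw [h₁]
      have hlt := lt_mul_of_one_lt_left hy0 hp1
      exact ⟨hxy.1.trans_lt hlt, h₂.trans_lt hlt⟩
    · obtain rfl : b' = false := by simpa using hw.1
      simp only [cond_false] at hxy
      obtain ⟨h₁, h₂⟩ := padicNorm_step_one (hN 0 0) (hN 0 1)
        (padicNorm_lower_of_notMem_range_iOne hpn hg) (hN 1 1) hxy.2
      simp only [cond_true, jBool, jOne_coe]
      rw [h₁]
      exact ⟨hxy.1.le, h₂, fun _ => hxy.1⟩

/-- `SL_2(ℤ[1/pn])` is the amalgam of two copies of `SL_2(ℤ[1/n])` over `Γ_0(n, p)`. -/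
theorem isAmalgam_SL2Z (hp : p ≠ 0) (hn : n ≠ 0) (hpn : ¬ p ∣ n) :
    IsAmalgam (iOne n p) (iTwo n p hp) (jOne n p hp) (jTwo n p hp hn) := by
  refine isAmalgam_of_reduced_words (iBool n p hp) (jBool n p hp hn) (jOne_comp_iOne hp hn) ?_
    (jOne_injective hp) (jSup_eq_top hp hn) ?_
  · rintro (_ | _)
    · exact iTwo_injective hp hn
    · exact iOne_injective
  · rintro (_ | ⟨⟨b, g⟩, w⟩) hnil hr hw c hc
    · exact hnil rfl
    obtain ⟨k, x, y, hx, hy, hxy⟩ := padicNorm_column_of_reduced hp hn hpn b g w hr hw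
    rw [List.map_cons, List.prod_cons] at hc
    rw [hc] at hx hy
    have hx1 : padicNorm p x ≤ 1 := hx ▸ padicNorm_SL2Z_le_one hpn (iOne n p c) 0 k
    have hy1 : padicNorm p y ≤ 1 := hy ▸ padicNorm_SL2Z_le_one hpn (iOne n p c) 1 k
    cases b
    · exact (hx1.trans_lt hxy.1).false
    -- A single letter of the first factor produces no norm above 1; it is excluded by injectivity
    -- of `j_1` instead.
    · rcases eq_or_ne w [] with rfl | hne
      · rw [List.map_nil, List.prod_nil, mul_one] at hc
        exact hr _ List.mem_cons_self ⟨c, (jOne_injective hp hc).symm⟩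
      · exact (hy1.trans_lt (hxy.2.2 hne)).false

end Words


/-! ### Homomorphisms from `SL_2(ℤ)` to abelian groups -/

section Modular

open ModularGroup

/-- A homomorphism from `SL_2(ℤ)` to an abelian group is determined by a function which transforms
in the same way under right multiplication by the generators. -/
theorem hom_SL2_eq {A : Type} [AddCommGroup A] {N : ℕ}
    (F : Matrix.SpecialLinearGroup (Fin 2) ℤ →* Multiplicative A) (ψ : ZMod N →+ A)
    (χ : Matrix.SpecialLinearGroup (Fin 2) ℤ → ZMod N) (s t : ZMod N) (h1 : χ 1 = 0)
    (hS : ∀ g, χ (g * S) = χ g + s) (hT : ∀ g, χ (g * T) = χ g + t)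
    (hFS : (F S).toAdd = ψ s) (hFT : (F T).toAdd = ψ t)
    (g : Matrix.SpecialLinearGroup (Fin 2) ℤ) : (F g).toAdd = ψ (χ g) := by
  have key (y : Matrix.SpecialLinearGroup (Fin 2) ℤ) (hy : y ∈ ({S, T} : Set _)) :
      ∃ e, (F y).toAdd = ψ e ∧ ∀ g, χ (g * y) = χ g + e := by
    rcases hy with rfl | rfl
    exacts [⟨s, hFS, hS⟩, ⟨t, hFT, hT⟩]
  have hg : g ∈ Subgroup.closure {S, T} := by
    rw [SpecialLinearGroup.SL2Z_generators]
    exact Subgroup.mem_top g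
  induction hg using Subgroup.closure_induction_right with
  | one => rw [h1, map_one, map_zero, toAdd_one]
  | mul_right x _ y hy ih =>
    obtain ⟨e, he, hχ⟩ := key y hy
    rw [map_mul, toAdd_mul, ih, he, hχ, map_add]
  | mul_inv_cancel x _ y hy ih =>
    obtain ⟨e, he, hχ⟩ := key y hy
    have := hχ (x * y⁻¹)
    rw [inv_mul_cancel_right] at this
    rw [this, map_add, ← he] at ih
    rw [map_mul, toAdd_mul, ih, map_inv, toAdd_inv, add_neg_cancel_right]

/-- The reduction modulo `N` of the residue of a matrix under the homomorphism `SL_2(ℤ) → ℤ/12`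
which maps `(1, 1; 0, 1)` to `1`, in terms of the entries of the matrix. -/
def chiTwelve {N : ℕ} (a b c d : ZMod N) : ZMod N :=
  (1 - c ^ 2) * (b * d + 3 * (c - 1) * d + c + 3) + c * (a + d - 3)

/-- The arguments on the left are the entries after right multiplication by `S` and `T`. The
increments 0 and 1 reflect `S = -3 T` in the abelianization; modulo 4 they become 1 and 1. -/
theorem chiTwelve_three : ∀ a b c d : ZMod 3, a * d - b * c = 1 →
    chiTwelve b (-a) d (-c) = chiTwelve a b c d ∧
    chiTwelve a (a + b) c (c + d) = chiTwelve a b c d + 1 := by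
  unfold chiTwelve
  decide

theorem chiTwelve_four : ∀ a b c d : ZMod 4, a * d - b * c = 1 →
    chiTwelve b (-a) d (-c) = chiTwelve a b c d + 1 ∧
    chiTwelve a (a + b) c (c + d) = chiTwelve a b c d + 1 := by
  unfold chiTwelve
  decide

/-- The function `chiTwelve` on the entries of an integral matrix. -/
def chiSL2 (N : ℕ) (g : Matrix.SpecialLinearGroup (Fin 2) ℤ) : ZMod N :=
  chiTwelve (g 0 0 : ZMod N) (g 0 1 : ZMod N) (g 1 0 : ZMod N) (g 1 1 : ZMod N)

theorem SL2_det_cast (N : ℕ) (g : Matrix.SpecialLinearGroup (Fin 2) ℤ) :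
    (g 0 0 : ZMod N) * (g 1 1 : ZMod N) - (g 0 1 : ZMod N) * (g 1 0 : ZMod N) = 1 := by
  have h := congrArg (Int.cast : ℤ → ZMod N) (SL2_det_eq g)
  push_cast at h
  exact h

theorem chiSL2_mul_S (N : ℕ) (g : Matrix.SpecialLinearGroup (Fin 2) ℤ) :
    chiSL2 N (g * S) = chiTwelve (g 0 1 : ZMod N) (-(g 0 0 : ZMod N)) (g 1 1 : ZMod N)
      (-(g 1 0 : ZMod N)) := by
  simp only [chiSL2, SL2_mul_entry]
  simp [S]

theorem chiSL2_mul_T (N : ℕ) (g : Matrix.SpecialLinearGroup (Fin 2) ℤ) :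
    chiSL2 N (g * T) = chiTwelve (g 0 0 : ZMod N) (g 0 0 + g 0 1 : ZMod N) (g 1 0 : ZMod N)
      (g 1 0 + g 1 1 : ZMod N) := by
  simp only [chiSL2, SL2_mul_entry]
  simp [T]

theorem S_pow_four : (S : Matrix.SpecialLinearGroup (Fin 2) ℤ) ^ 4 = 1 := by
  decide +kernel

theorem S_mul_T_pow_three : ((S * T) ^ 3 : Matrix.SpecialLinearGroup (Fin 2) ℤ) = S ^ 2 := by
  decide +kernel

/-- The principal congruence subgroup of level `12` is in the commutator subgroup of
`SL_2(ℤ)`. -/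
theorem hom_eq_one_of_congr_one {A : Type} [AddCommGroup A]
    (f : Matrix.SpecialLinearGroup (Fin 2) ℤ →* Multiplicative A)
    {g : Matrix.SpecialLinearGroup (Fin 2) ℤ} (h00 : (12 : ℤ) ∣ g 0 0 - 1)
    (h01 : (12 : ℤ) ∣ g 0 1) (h10 : (12 : ℤ) ∣ g 1 0) (h11 : (12 : ℤ) ∣ g 1 1 - 1) : f g = 1 := by
  obtain ⟨s, hs⟩ : ∃ s : A, (f S).toAdd = s := ⟨_, rfl⟩
  obtain ⟨t, ht⟩ : ∃ t : A, (f T).toAdd = t := ⟨_, rfl⟩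
  -- The relations `S ^ 4 = 1` and `(S T) ^ 3 = S ^ 2` give `s = -3 t` and `12 t = 0`. Hence `4 f`
  -- factors through the residue modulo 3 and `3 f` through that modulo 4; both vanish at `g`, and
  -- `f = 4 f - 3 f`.
  have h4 : (4 : ℤ) • s = 0 := by
    have := congrArg (fun x => (f x).toAdd) S_pow_four
    simp only [map_pow, toAdd_pow, hs, map_one, toAdd_one] at this
    exact_mod_cast this
  have h3 : s = (-3 : ℤ) • t := by
    have := congrArg (fun x => (f x).toAdd) S_mul_T_pow_three
    simp only [map_pow, map_mul, toAdd_pow, toAdd_mul, hs, ht] at this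
    have e : (3 : ℕ) • (s + t) - (2 : ℕ) • s = s + (3 : ℤ) • t := by module
    rw [this, sub_self] at e
    rw [neg_smul]
    exact eq_neg_of_add_eq_zero_left e.symm
  have h12 : (12 : ℤ) • t = 0 := by
    rw [h3, smul_smul] at h4
    rw [← neg_eq_zero, ← neg_smul]
    exact h4
  have hχ (N : ℕ) (hN : N ∣ 12) : chiSL2 N g = 0 := by
    have hc (z : ℤ) (hz : (12 : ℤ) ∣ z) : (z : ZMod N) = 0 :=
      (ZMod.intCast_zmod_eq_zero_iff_dvd z N).2 ((Int.natCast_dvd_natCast.2 hN).trans hz)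
    have e00 := hc _ h00
    have e01 := hc _ h01
    have e10 := hc _ h10
    have e11 := hc _ h11
    push_cast at e00 e11
    rw [sub_eq_zero] at e00 e11
    simp [chiSL2, chiTwelve, e00, e01, e10, e11]
  have h1 (N : ℕ) : chiSL2 N 1 = 0 := by simp [chiSL2, chiTwelve]
  have hlift (N : ℕ) (x : A) (hx : (N : ℤ) • x = 0) : ∃ ψ : ZMod N →+ A, ψ 1 = x := by
    refine ⟨ZMod.lift N ⟨zmultiplesHom A x, hx⟩, ?_⟩
    have := ZMod.lift_coe N ⟨zmultiplesHom A x, hx⟩ 1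
    simpa using this
  have e3 : (4 : ℕ) • (f g).toAdd = 0 := by
    obtain ⟨ψ, hψ⟩ := hlift 3 ((4 : ℕ) • t) (by
      rw [← h12, ← natCast_zsmul, smul_smul]
      norm_num)
    have := hom_SL2_eq ((powMonoidHom 4).comp f) ψ (chiSL2 3) 0 1 (h1 3)
      (fun g => by
        rw [chiSL2_mul_S, (chiTwelve_three _ _ _ _ (SL2_det_cast 3 g)).1, add_zero]
        rfl)
      (fun g => by
        rw [chiSL2_mul_T, (chiTwelve_three _ _ _ _ (SL2_det_cast 3 g)).2]
        rfl)
      (by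
        simp only [MonoidHom.comp_apply, powMonoidHom_apply, toAdd_pow, hs, map_zero]
        exact_mod_cast h4)
      (by simp only [MonoidHom.comp_apply, powMonoidHom_apply, toAdd_pow, ht, hψ]) g
    rw [hχ 3 (by norm_num), map_zero] at this
    exact this
  have e4 : (3 : ℕ) • (f g).toAdd = 0 := by
    obtain ⟨ψ, hψ⟩ := hlift 4 ((3 : ℕ) • t) (by
      rw [← h12, ← natCast_zsmul, smul_smul]
      norm_num)
    have := hom_SL2_eq ((powMonoidHom 3).comp f) ψ (chiSL2 4) 1 1 (h1 4)
      (fun g => by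
        rw [chiSL2_mul_S, (chiTwelve_four _ _ _ _ (SL2_det_cast 4 g)).1]
        rfl)
      (fun g => by
        rw [chiSL2_mul_T, (chiTwelve_four _ _ _ _ (SL2_det_cast 4 g)).2]
        rfl)
      (by
        simp only [MonoidHom.comp_apply, powMonoidHom_apply, toAdd_pow, hs, h3, hψ]
        rw [← sub_eq_zero, show (3 : ℕ) • (-3 : ℤ) • t - (3 : ℕ) • t = -((12 : ℤ) • t) by module,
          h12, neg_zero])
      (by simp only [MonoidHom.comp_apply, powMonoidHom_apply, toAdd_pow, ht, hψ]) g
    rw [hχ 4 (by norm_num), map_zero] at this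
    exact this
  have : (f g).toAdd = 0 := by
    rw [show (f g).toAdd = (4 : ℕ) • (f g).toAdd - (3 : ℕ) • (f g).toAdd by module, e3, e4,
      sub_zero]
  exact Multiplicative.toAdd.injective this

end Modular

/-! ### Classes that realize every unit of `𝔽_p` -/

section Surjectivity

theorem HZmap_toHZOne {G H : Type} [Group G] [Group H] (f : G →* H) (g : G) :
    HZmap f 1 (toHZOne G g).toAdd = (toHZOne H (f g)).toAdd := by
  refine (groupHomology.H1π_comp_map_apply f (trivZHom f) _).trans ?_
  refine congrArg (groupHomology.H1π (trivZ H)) (Subtype.ext ?_)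
  refine (groupHomology.coe_mapCycles₁ f (trivZHom f) _).trans ?_
  change Finsupp.mapRange.linearMap (trivZHom f).hom.toLinearMap
    (Finsupp.mapDomain f (Finsupp.single g (1 : ℤ))) = _
  rw [Finsupp.mapDomain_single]
  exact Finsupp.mapRange_single (hf := map_zero (trivZHom f).hom.toLinearMap)

theorem H1Lift_toHZOne {G M : Type} [Group G] [CommGroup M] (f : G →* M) (g : G) :
    H1Lift f (toHZOne G g).toAdd = Additive.ofMul (f g) :=
  H1Lift_apply f g

/-- The chain `[g]` is a boundary if the class of `g` in `H_1` is trivial. -/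
theorem exists_bdry₂_eq_single {G : Type} [Group G] {g : G} (h : toHZOne G g = 1) :
    ∃ a, bdry₂ G a = Finsupp.single g 1 :=
  (groupHomology.H1π_eq_zero_iff _).1 (congrArg Multiplicative.toAdd h)

theorem IsAmalgam.exists_mem_graph_right {C A B G : Type} [Group C] [Group A] [Group B] [Group G]
    {i₁ : C →* A} {i₂ : C →* B} {j₁ : A →* G} {j₂ : B →* G} (h : IsAmalgam i₁ i₂ j₁ j₂) {g : C}
    (h₁ : toHZOne A (i₁ g) = 1) (h₂ : toHZOne B (i₂ g) = 1) :
    ∃ x, (x, (toHZOne C g).toAdd) ∈ mayerVietorisGraph i₁ i₂ j₁ j₂ := by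
  obtain ⟨a, ha⟩ := exists_bdry₂_eq_single h₁
  obtain ⟨b, hb⟩ := exists_bdry₂_eq_single h₂
  rw [← chain₁_single] at ha hb
  exact ⟨_, a, b, ⟨_, mem_cycles₁_trivZ _⟩, ⟨_, h.chain_cycle ha hb⟩, ha, hb, rfl, rfl, rfl⟩

variable {n p : ℕ}

/-- Since `p > 3`, 12 is invertible modulo `p`, so some `a = 1 + 12k` reduces to `u`. It is coprime
to `144p`, and Bézout supplies the rest. -/
theorem exists_int_of_unit [Fact p.Prime] (hp : 3 < p) (u : (ZMod p)ˣ) :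
    ∃ a b d : ℤ, (a : ZMod p) = u ∧ (12 : ℤ) ∣ a - 1 ∧ a * d - 144 * p * b = 1 := by
  have hp' : p.Prime := Fact.out
  have h12 : ((12 : ℕ) : ZMod p) ≠ 0 := by
    rw [Ne, ZMod.natCast_eq_zero_iff, show 12 = 2 * 2 * 3 by norm_num, hp'.dvd_mul, hp'.dvd_mul]
    rintro ((h | h) | h) <;> have := Nat.le_of_dvd (by norm_num) h <;> omega
  let k : ℤ := (((u : ZMod p) - 1) / (12 : ℕ) : ZMod p).val
  have hk : (k : ZMod p) = ((u : ZMod p) - 1) / (12 : ℕ) := by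
    rw [Int.cast_natCast, ZMod.natCast_zmod_val]
  have ha : ((1 + 12 * k : ℤ) : ZMod p) = u := by
    push_cast at hk h12 ⊢
    rw [hk, mul_div_cancel₀ _ h12, add_sub_cancel]
  have h1 : IsCoprime (1 + 12 * k) (12 : ℤ) := ⟨1, -k, by ring⟩
  have h2 : IsCoprime (1 + 12 * k) (p : ℤ) := by
    rw [isCoprime_comm, Prime.coprime_iff_not_dvd (Nat.prime_iff_prime_int.1 hp'),
      ← ZMod.intCast_zmod_eq_zero_iff_dvd, ha]
    exact u.ne_zero
  obtain ⟨d, b, hdb⟩ := (h1.mul_right h1).mul_right h2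
  exact ⟨1 + 12 * k, -b, d, ha, ⟨k, by ring⟩, by linear_combination hdb⟩

theorem exists_Gamma0_of_unit [Fact p.Prime] (hp : 3 < p) (hp0 : p ≠ 0) (hpn : ¬ p ∣ n)
    (u : (ZMod p)ˣ) :
    ∃ g : Gamma0 n p, borelPr p (redBorel n p hpn g) = u ∧
      toHZOne (SL2Z n) (iOne n p g) = 1 ∧ toHZOne (SL2Z n) (iTwo n p hp0 g) = 1 := by
  obtain ⟨a, b, d, hau, ha, hab⟩ := exists_int_of_unit hp u
  have hpQ : (p : ℚ) ≠ 0 := by exact_mod_cast hp0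
  have hd : (12 : ℤ) ∣ d - 1 := by
    obtain ⟨k, hk⟩ := ha
    exact ⟨12 * p * b - k * d, by linear_combination hab - d * hk⟩
  let φ : Matrix.SpecialLinearGroup (Fin 2) ℤ →* SL2Z n :=
    Matrix.SpecialLinearGroup.map (Int.castRingHom (ZInv n))
  have hφ (g : Matrix.SpecialLinearGroup (Fin 2) ℤ) (i j : Fin 2) :
      φ g i j = ((g i j : ℤ) : ZInv n) := rfl
  -- The lower left entry `12 * p` stays divisible by 12 after `i_2'` removes the factor `p`, so
  -- `g₁` and its image `g₂` are both congruent to 1 modulo 12.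
  let g₁ : Matrix.SpecialLinearGroup (Fin 2) ℤ := mkSL2 a (12 * b) (12 * p) d (by
    linear_combination hab)
  let g₂ : Matrix.SpecialLinearGroup (Fin 2) ℤ := mkSL2 a (12 * p * b) 12 d (by
    linear_combination hab)
  have hg : φ g₁ ∈ Gamma0 n p := ⟨12, by
    rw [hφ]
    simp [g₁, mkSL2, mul_comm]⟩
  have h₂ : iTwo n p hp0 ⟨φ g₁, hg⟩ = φ g₂ := by
    obtain ⟨k₁, k₂, k₃, k₄⟩ := iTwo_coe hp0 (⟨φ g₁, hg⟩ : Gamma0 n p)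
    refine SL2Z_ext_entries (k₁.trans ?_) (k₂.trans ?_) (k₃.trans ?_) (k₄.trans ?_)
    · rfl
    · rw [hφ, hφ]
      simp [g₁, g₂, mkSL2]
      ring
    · rw [hφ, hφ]
      simp [g₁, g₂, mkSL2]
      field_simp
    · rfl
  refine ⟨⟨φ g₁, hg⟩, ?_, ?_, ?_⟩
  · ext
    change ZInv.red n p hpn ((a : ℤ) : ZInv n) = u
    rw [map_intCast, hau]
  · exact hom_eq_one_of_congr_one ((toHZOne (SL2Z n)).comp φ) (g := g₁) ha ⟨b, rfl⟩ ⟨p, rfl⟩ hd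
  · rw [h₂]
    exact hom_eq_one_of_congr_one ((toHZOne (SL2Z n)).comp φ) (g := g₂) ha
      ⟨p * b, mul_assoc _ _ _⟩ ⟨1, rfl⟩ hd

end Surjectivity

end

theorem lemma6p2 (n p : ℕ) [Fact p.Prime] (hn : 1 < n) (hsq : Squarefree n) (hp : 3 < p)
    (hpn : ¬ p ∣ n) :
    ∃ conn : HZ (SL2Z (p * n)) 2 →+ HZ (Gamma0 n p) 1,
      IsMayerVietorisConnecting n p (by omega) (by omega) conn ∧
      Function.Surjective ((H1ToUnits n p hpn).comp conn) := by
  have h := isAmalgam_SL2Z (n := n) (p := p) (by omega) (by omega) hpn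
  obtain ⟨conn, hconn⟩ := h.exists_connecting
  refine ⟨conn, hconn, fun u => ?_⟩
  obtain ⟨g, hgu, h₁, h₂⟩ := exists_Gamma0_of_unit hp (by omega) hpn u.toMul
  obtain ⟨x, hx⟩ := h.exists_mem_graph_right h₁ h₂
  rw [← hconn, AddMonoidHom.mem_graph] at hx
  refine ⟨x, ?_⟩
  have e : H1Lift (borelPr p) (HZmap (redBorel n p hpn) 1 (conn x)) = u := by
    rw [hx, HZmap_toHZOne, H1Lift_toHZOne, hgu]
    rfl
  exact e
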